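/- Let $\mathbb H$ be the quaternions with elements $y=y_0+\mathbf i y_1+\mathbf j y_2+\mathbf k y_3$, and let $M=S^3\subset\mathbb H$ be the unit sphere with the $3$-form $$\mathrm{dvol}_M=y_0\,dy_1dy_2dy_3-y_1\,dy_0dy_2dy_3-y_2\,dy_0dy_3dy_1-y_3\,dy_0dy_1dy_2 .$$ A (positive) divergence free frame on $M$ is a triple $v=(v_1,v_2,v_3)$ of smooth vector fields with $d\,\iota(v_i)\mathrm{dvol}_M=0$ for $i=1,2,3$ and $\mathrm{dvol}_M(v_1,v_2,v_3)>0$ everywhere. It is called normal if $\mathrm{dvol}_M(v_1,v_2,v_3)=1$. Its Fueter operator acts on smooth functions $f:M\to\mathbb H$ by $$\partial\!\!\!/_v f=\mathbf i\,\partial_{v_1}f+\mathbf j\,\partial_{v_2}f+\mathbf k\,\partial_{v_3}f .$$ The frame is called regular if every smooth $f:M\to\mathbb H$ with $\partial\!\!\!/_vf=0$ is constant, and singular otherwise. Brackets of vector fields are taken with the sign convention $\mathcal L_{[u,w]}=-[\mathcal L_u,\mathcal L_w]$. Then the following hold. (1) $\mathrm{dvol}_M$ is a volume form (smooth and nowhere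 vanishing), and the measure it defines is the Euclidean surface measure of $S^3$. (2) The frame $v_1(y)=\mathbf i y$, $v_2(y)=\mathbf j y$, $v_3(y)=\mathbf k y$ is a normal regular divergence free frame. Its dual frame, given by $\alpha_i(v_j)=\delta_{ij}$, consists of the restrictions to $S^3$ of $$\alpha_1=y_0dy_1-y_1dy_0+y_2dy_3-y_3dy_2,\quad \alpha_2=y_0dy_2-y_2dy_0+y_3dy_1-y_1dy_3,\quad \alpha_3=y_0dy_3-y_3dy_0+y_1dy_2-y_2dy_1 .$$ For every cyclic permutation $i,j,k$ of $1,2,3$ we have $[v_j,v_k]=2v_i$ and $d\alpha_i=2\,\alpha_j\wedge\alpha_k=2\,\iota(v_i)\mathrm{dvol}_M$. Every smooth $f:M\to\mathbb H$ satisfies, with $|df|^2:=\sum_i|\partial_{v_i}f|^2$, the energy identity $$\frac12\int_M|df|^2\,\mathrm{dvol}_M=\frac12\int_M|\partial\!\!\!/_vf|^2\,\mathrm{dvol}_M+\int_M\langle f,\partial\!\!\!/_vf\rangle\,\mathrm{dvol}_M .$$ (3) The frame $v_1(y)=2^{2/3}\,\mathbf i y$, $v_2(y)=-2^{-1/3}\,\mathbf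 j y$, $v_3(y)=-2^{-1/3}\,\mathbf k y$ is a normal singular divergence free frame for $\mathrm{dvol}_M$, and the inclusion $S^3\to\mathbb H$ is a smooth nonconstant solution of its Fueter equation $\partial\!\!\!/_vf=0$. -/

import Mathlib

open scoped Manifold ContDiff Quaternion

noncomputable section

/-! ### Forms, frames and the Fueter operator on a three-manifold -/

namespace Fueter

/-- The model space `ℝ³`. -/
abbrev E3 : Type := EuclideanSpace ℝ (Fin 3)

/-- The decomposable `k`-form `α₀ ∧ … ∧ α_{k-1}`, normalised by
`(α₀ ∧ … ∧ α_{k-1}) (w₀, …, w_{k-1}) = det (αᵢ (wⱼ))`. -/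
def wedge {V : Type*} [AddCommGroup V] [Module ℝ V] [TopologicalSpace V] {k : ℕ}
    (α : Fin k → (V →L[ℝ] ℝ)) : V [⋀^Fin k]→L[ℝ] ℝ :=
  { (Matrix.detRowAlternating (R := ℝ) (n := Fin k)).compLinearMap
      (LinearMap.pi fun i => ((α i : V →L[ℝ] ℝ) : V →ₗ[ℝ] ℝ)) with
    cont := by
      change Continuous fun w : Fin k → V => Matrix.det (fun j i => α i (w j))
      exact Continuous.matrix_det (by fun_prop) }

theorem wedge_apply {V : Type*} [AddCommGroup V] [Module ℝ V] [TopologicalSpace V] {k : ℕ}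
    (α : Fin k → (V →L[ℝ] ℝ)) (w : Fin k → V) :
    wedge α w = Matrix.det (Matrix.of fun i j => α i (w j)) := by
  rw [← Matrix.det_transpose]
  rfl

section Manifold

variable (M : Type*) [TopologicalSpace M] [ChartedSpace E3 M]

/-- Vector fields on `M` (smoothness is a separate predicate). -/
abbrev VField : Type _ := (x : M) → TangentSpace (𝓡 3) x

/-- Differential `k`-forms on `M` (smoothness is a separate predicate). -/
abbrev DForm (k : ℕ) : Type _ := (x : M) → TangentSpace (𝓡 3) x [⋀^Fin k]→L[ℝ] ℝ

variable {M}

/-- The representative on `ℝ³` of the form `η` in the chart centred at `x`: the pullback of `η`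
under the inverse of the chart. It is meaningful on the target of the chart. -/
def DForm.inChart {k : ℕ} (η : DForm M k) (x : M) (z : E3) : E3 [⋀^Fin k]→L[ℝ] ℝ :=
  (η ((extChartAt (𝓡 3) x).symm z)).compContinuousLinearMap
    ((mfderiv 𝓘(ℝ, E3) (𝓡 3) (extChartAt (𝓡 3) x).symm z).comp
      ((NormedSpace.fromTangentSpace (𝕜 := ℝ) z).symm : E3 →L[ℝ] TangentSpace 𝓘(ℝ, E3) z))

/-- A form is smooth when its representatives in the charts are smooth. -/
def DForm.IsSmooth {k : ℕ} (η : DForm M k) : Prop :=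
  ∀ x : M, ContDiffOn ℝ ∞ (η.inChart x) (extChartAt (𝓡 3) x).target

/-- The exterior derivative: at `x`, differentiate the representative in the chart centred at `x`
and pull the result back under the chart. -/
def DForm.d {k : ℕ} (η : DForm M k) : DForm M (k + 1) := fun x =>
  (extDeriv (η.inChart x) (extChartAt (𝓡 3) x x)).compContinuousLinearMap
    (mvfderiv (𝓡 3) (extChartAt (𝓡 3) x) x)

/-- The interior product `ι(u)η = η(u, ·, …, ·)`. -/
def DForm.interior {k : ℕ} (u : VField M) (η : DForm M (k + 1)) : DForm M k := fun x =>
  { (η x).toAlternatingMap.curryLeft (u x) with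
    cont := by
      change Continuous fun w : Fin k → TangentSpace (𝓡 3) x => η x (Matrix.vecCons (u x) w)
      exact (η x).cont.comp (continuous_const.matrixVecCons continuous_id) }

theorem DForm.interior_apply {k : ℕ} (u : VField M) (η : DForm M (k + 1)) (x : M)
    (w : Fin k → TangentSpace (𝓡 3) x) :
    DForm.interior u η x w = η x (Matrix.vecCons (u x) w) := rfl

/-- A volume form: a smooth, nowhere vanishing `3`-form. It orients the manifold. -/
def IsVolumeForm (η : DForm M 3) : Prop := η.IsSmooth ∧ ∀ x, η x ≠ 0

/-- `μ` is the measure of the volume form `η`, i.e. `∫ h dμ = ∫ h η` for the orientation given by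
`η`: in every chart, `μ` has density `|η(∂₁, ∂₂, ∂₃)|` with respect to Lebesgue measure. -/
def IsMeasureOf [MeasurableSpace M] (μ : MeasureTheory.Measure M) (η : DForm M 3) : Prop :=
  ∀ x : M, ∀ A : Set M, MeasurableSet A → A ⊆ (extChartAt (𝓡 3) x).source →
    μ A = ∫⁻ z in extChartAt (𝓡 3) x '' A,
      ENNReal.ofReal |η.inChart x z fun i => EuclideanSpace.single i 1|

/-- The derivative `∂_u f` of a quaternion valued function along a vector field. -/
def dirDeriv (u : VField M) (f : M → ℍ[ℝ]) (x : M) : ℍ[ℝ] := mvfderiv (𝓡 3) f x (u x)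

/-- The imaginary units `i, j, k`. -/
def imUnit : Fin 3 → ℍ[ℝ] := ![⟨0, 1, 0, 0⟩, ⟨0, 0, 1, 0⟩, ⟨0, 0, 0, 1⟩]

/-- The Fueter operator `f ↦ i ∂_{v₁} f + j ∂_{v₂} f + k ∂_{v₃} f`. -/
def fueter (v : Fin 3 → VField M) (f : M → ℍ[ℝ]) (x : M) : ℍ[ℝ] :=
  ∑ i, imUnit i * dirDeriv (v i) f x

/-- Smooth maps `M → ℍ`. -/
def SmoothMap (f : M → ℍ[ℝ]) : Prop := ContMDiff (𝓡 3) 𝓘(ℝ, ℍ[ℝ]) ∞ f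

/-- Smooth vector fields. -/
def SmoothField [IsManifold (𝓡 3) ∞ M] (u : VField M) : Prop :=
  ContMDiff (𝓡 3) (𝓡 3).tangent ∞ fun x => (⟨x, u x⟩ : TangentBundle (𝓡 3) M)

/-- The function `η(v₁, v₂, v₃)`. -/
def onFrame (η : DForm M 3) (v : Fin 3 → VField M) (x : M) : ℝ := η x fun i => v i x

/-- Positive divergence free frames for the volume form `η`. -/
structure IsDivFreeFrame [IsManifold (𝓡 3) ∞ M] (η : DForm M 3) (v : Fin 3 → VField M) : Prop where
  smooth : ∀ i, SmoothField (v i)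
  divFree : ∀ i, (DForm.interior (v i) η).d = 0
  positive : ∀ x, 0 < onFrame η v x

/-- A frame is normal when `η(v₁, v₂, v₃) = 1`. -/
def IsNormal (η : DForm M 3) (v : Fin 3 → VField M) : Prop := ∀ x, onFrame η v x = 1

/-- Every smooth solution of the Fueter equation is constant. -/
def OnlyConstantSolutions (v : Fin 3 → VField M) : Prop :=
  ∀ f : M → ℍ[ℝ], SmoothMap f → (∀ x, fueter v f x = 0) → ∃ c, ∀ x, f x = c

/-- Regular divergence free frames. -/
def IsRegularFrame [IsManifold (𝓡 3) ∞ M] (η : DForm M 3) (v : Fin 3 → VField M) : Prop :=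
  IsDivFreeFrame η v ∧ OnlyConstantSolutions v

/-- Singular divergence free frames. -/
def IsSingularFrame [IsManifold (𝓡 3) ∞ M] (η : DForm M 3) (v : Fin 3 → VField M) : Prop :=
  IsDivFreeFrame η v ∧ ¬ OnlyConstantSolutions v

/-- The bracket of vector fields with the sign convention `L_{[u,w]} = -[L_u, L_w]`, which is
opposite to the one of `VectorField.mlieBracket`. -/
def bracket (u w : VField M) : VField M := fun x => - VectorField.mlieBracket (𝓡 3) u w x

end Manifold

/-! ### The unit sphere in the quaternions -/

instance finrank_quaternion_fact : Fact (Module.finrank ℝ ℍ[ℝ] = 3 + 1) :=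
  ⟨Quaternion.finrank_eq_four⟩

instance measurableSpaceQuaternion : MeasurableSpace ℍ[ℝ] := borel ℍ[ℝ]

instance borelSpaceQuaternion : BorelSpace ℍ[ℝ] := ⟨rfl⟩

/-- The unit sphere `S³ ⊂ ℍ`. -/
abbrev S3 : Type := Metric.sphere (0 : ℍ[ℝ]) 1

/-- The inclusion `S³ → ℍ`. -/
def incl : S3 → ℍ[ℝ] := Subtype.val

/-- The differential of the inclusion `S³ → ℍ`. -/
def dincl (y : S3) : TangentSpace (𝓡 3) y →L[ℝ] ℍ[ℝ] := mvfderiv (𝓡 3) incl y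

/-- The coordinate covectors `dy₀, dy₁, dy₂, dy₃` on `ℍ`. -/
def dy : Fin 4 → (ℍ[ℝ] →L[ℝ] ℝ) :=
  ![LinearMap.toContinuousLinearMap
      { toFun := fun x => x.re, map_add' := fun _ _ => rfl, map_smul' := fun _ _ => rfl },
    LinearMap.toContinuousLinearMap
      { toFun := fun x => x.imI, map_add' := fun _ _ => rfl, map_smul' := fun _ _ => rfl },
    LinearMap.toContinuousLinearMap
      { toFun := fun x => x.imJ, map_add' := fun _ _ => rfl, map_smul' := fun _ _ => rfl },
    LinearMap.toContinuousLinearMap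
      { toFun := fun x => x.imK, map_add' := fun _ _ => rfl, map_smul' := fun _ _ => rfl }]

theorem dy_zero (x : ℍ[ℝ]) : dy 0 x = x.re := rfl

theorem dy_one (x : ℍ[ℝ]) : dy 1 x = x.imI := rfl

theorem dy_two (x : ℍ[ℝ]) : dy 2 x = x.imJ := rfl

theorem dy_three (x : ℍ[ℝ]) : dy 3 x = x.imK := rfl

/-- The volume form
`y₀ dy₁ dy₂ dy₃ - y₁ dy₀ dy₂ dy₃ - y₂ dy₀ dy₃ dy₁ - y₃ dy₀ dy₁ dy₂` on `S³`. -/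
def dvol : DForm S3 3 := fun y =>
  ((y : ℍ[ℝ]).re • wedge ![dy 1, dy 2, dy 3] - (y : ℍ[ℝ]).imI • wedge ![dy 0, dy 2, dy 3]
    - (y : ℍ[ℝ]).imJ • wedge ![dy 0, dy 3, dy 1]
    - (y : ℍ[ℝ]).imK • wedge ![dy 0, dy 1, dy 2]).compContinuousLinearMap (dincl y)

/-- The covectors of the dual frame
`α₁ = y₀ dy₁ - y₁ dy₀ + y₂ dy₃ - y₃ dy₂`, `α₂ = y₀ dy₂ - y₂ dy₀ + y₃ dy₁ - y₁ dy₃`,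
`α₃ = y₀ dy₃ - y₃ dy₀ + y₁ dy₂ - y₂ dy₁`, restricted to `S³`. -/
def coframe (i : Fin 3) (y : S3) : TangentSpace (𝓡 3) y →L[ℝ] ℝ :=
  ((![(y : ℍ[ℝ]).re • dy 1 - (y : ℍ[ℝ]).imI • dy 0 + (y : ℍ[ℝ]).imJ • dy 3
        - (y : ℍ[ℝ]).imK • dy 2,
      (y : ℍ[ℝ]).re • dy 2 - (y : ℍ[ℝ]).imJ • dy 0 + (y : ℍ[ℝ]).imK • dy 1
        - (y : ℍ[ℝ]).imI • dy 3,
      (y : ℍ[ℝ]).re • dy 3 - (y : ℍ[ℝ]).imK • dy 0 + (y : ℍ[ℝ]).imI • dy 2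
        - (y : ℍ[ℝ]).imJ • dy 1] : Fin 3 → (ℍ[ℝ] →L[ℝ] ℝ)) i).comp (dincl y)

/-- The `1`-form `αᵢ`. -/
def coframeForm (i : Fin 3) : DForm S3 1 := fun y => wedge ![coframe i y]

/-- The `2`-form `αᵢ ∧ αⱼ`. -/
def coframeWedge (i j : Fin 3) : DForm S3 2 := fun y => wedge ![coframe i y, coframe j y]

theorem exists_tangent (i : Fin 3) (y : S3) :
    ∃ u : TangentSpace (𝓡 3) y, dincl y u = imUnit i * (y : ℍ[ℝ]) := by
  have h : imUnit i * (y : ℍ[ℝ]) ∈ (Submodule.span ℝ {(y : ℍ[ℝ])})ᗮ := by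
    rw [Submodule.mem_orthogonal_singleton_iff_inner_right, Quaternion.inner_def]
    simp only [Quaternion.re_mul, Quaternion.re_star, Quaternion.imI_star, Quaternion.imJ_star,
      Quaternion.imK_star, Quaternion.imI_mul, Quaternion.imJ_mul, Quaternion.imK_mul]
    fin_cases i <;> simp [imUnit] <;> ring
  rw [← range_mvfderiv_subtypeVal (n := 3) y] at h
  exact h

/-- The vector fields `i y`, `j y`, `k y` on `S³`; see `dincl_stdFrame`. -/
def stdFrame (i : Fin 3) : VField S3 := fun y => (exists_tangent i y).choose

theorem dincl_stdFrame (i : Fin 3) (y : S3) :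
    dincl y (stdFrame i y) = imUnit i * (y : ℍ[ℝ]) := (exists_tangent i y).choose_spec

/-- The rescaled frame `2^{2/3} i y`, `-2^{-1/3} j y`, `-2^{-1/3} k y`. -/
def scaledFrame (i : Fin 3) : VField S3 := fun y =>
  (![(2 : ℝ) ^ (2 / 3 : ℝ), -(2 : ℝ) ^ (-(1 / 3) : ℝ), -(2 : ℝ) ^ (-(1 / 3) : ℝ)] : Fin 3 → ℝ) i
    • stdFrame i y

/-- The surface measure on `S³`. -/
def sphereMeasure : MeasureTheory.Measure S3 :=
  (MeasureTheory.volume : MeasureTheory.Measure ℍ[ℝ]).toSphere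

end Fueter

end

open Fueter

/-! Everything reduces to quaternion algebra in the ambient space. With `param x` the inclusion
composed with an inverse chart, forms restricted from `ℍ` become pullbacks under a smooth map `p :
ℝ³ → ℍ`. The vectors `eᵢ y` form an orthonormal basis of the tangent space at `y`, and `αᵢ = ⟨eᵢ y,
·⟩`. Differentiating `⟨eᵢ p, dp⟩`, or the relation `dp(X) = eᵢ p` that defines the fields in a
chart, produces second derivatives of `p` that cancel by symmetry. What remains is the commutator of
imaginary units: it gives `d_coframeForm` and `bracket_stdFrame`. The frame is divergence free
because `ι(vᵢ)dvol = αⱼ ∧ αₖ` is half of `dαᵢ`, hence closed.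

The flow of `vᵢ` is left multiplication by `exp (t eᵢ)`, an isometry, so `∂_{vᵢ}` of a function
integrates to zero. Expanding the square of the Fueter operator leaves the cross terms `⟨∂ⱼ f, eᵢ ∂ₖ
f⟩`; integrating them by parts and using the brackets turns them into `⟨f, eᵢ ∂ᵢ f⟩`. This is
`energy_identity`. A solution of the Fueter equation thus has zero differential, and is constant
since `S³` is connected.

For the rescaled frame, the inclusion is sent to `-(c₁ + c₂ + c₃) y`, and the weights sum to zero.
Finally, `sphereMeasure` is four times the volume of the cone over a set; the Jacobian of polar
coordinates is `r³` times the density of `dvol`, and `∫₀¹ r³ dr = 1/4`. -/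

namespace Fueter

/-! ### Smooth dependence of a decomposable form on its covectors -/

section Wedge
variable {V : Type*} [NormedAddCommGroup V] [NormedSpace ℝ V] {k : ℕ}

theorem wedge_compContinuousLinearMap {V W : Type*} [AddCommGroup V] [Module ℝ V]
    [TopologicalSpace V] [AddCommGroup W] [Module ℝ W] [TopologicalSpace W] {k : ℕ}
    (α : Fin k → (V →L[ℝ] ℝ)) (f : W →L[ℝ] V) :
    (wedge α).compContinuousLinearMap f = wedge fun i => (α i).comp f := by
  ext w
  simp [wedge_apply, Function.comp_def]

/-- The Leibniz formula for the determinant. It factors `wedge` as a continuous multilinear map in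
the covectors followed by a linear map, which is how smoothness is proved in `contDiff_wedge`. -/
theorem wedge_eq_alternatization (α : Fin k → (V →L[ℝ] ℝ)) :
    wedge α = ContinuousMultilinearMap.alternatization
      ((ContinuousMultilinearMap.mkPiAlgebra ℝ (Fin k) ℝ).compContinuousLinearMap α) := by
  ext w
  rw [wedge_apply, ContinuousMultilinearMap.alternatization_apply_apply, ← Matrix.det_transpose,
    Matrix.det_apply]
  simp

theorem isBoundedLinearMap_alternatization : IsBoundedLinearMap ℝ
    (ContinuousMultilinearMap.alternatization :
      ContinuousMultilinearMap ℝ (fun _ : Fin k => V) ℝ →+ V [⋀^Fin k]→L[ℝ] ℝ) := by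
  -- The bound is `k!`: each permutation contributes a term of norm at most `‖m‖ ∏ ‖wᵢ‖`.
  refine IsLinearMap.with_bound ⟨map_add _, fun c m => ?_⟩ (Fintype.card (Equiv.Perm (Fin k)))
    fun m => ?_
  · ext w
    simp [ContinuousMultilinearMap.alternatization_apply_apply, Finset.mul_sum, mul_smul_comm]
  · refine ContinuousAlternatingMap.opNorm_le_bound _ (by positivity) fun w => ?_
    rw [ContinuousMultilinearMap.alternatization_apply_apply, mul_assoc]
    refine (norm_sum_le _ _).trans ?_
    rw [← nsmul_eq_mul, ← Finset.card_univ]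
    refine Finset.sum_le_card_nsmul _ _ _ fun σ _ => ?_
    have h : ‖Equiv.Perm.sign σ • m (w ∘ σ)‖ = ‖m (w ∘ σ)‖ := by
      rcases Int.units_eq_one_or (Equiv.Perm.sign σ) with h | h <;> simp [h]
    rw [h]
    refine (m.le_opNorm _).trans_eq ?_
    rw [← Equiv.prod_comp σ fun i => ‖w i‖]
    rfl

theorem contDiff_wedge {n : ℕ∞ω} {E : Type*} [NormedAddCommGroup E] [NormedSpace ℝ E]
    {a : E → Fin k → (V →L[ℝ] ℝ)} (ha : ∀ i, ContDiff ℝ n fun z => a z i) :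
    ContDiff ℝ n fun z => wedge (a z) := by
  simp only [wedge_eq_alternatization]
  have h1 : ContDiff ℝ n fun z => (ContinuousMultilinearMap.mkPiAlgebra ℝ (Fin k) ℝ
      ).compContinuousLinearMap (a z) :=
    ((ContinuousMultilinearMap.compContinuousLinearMapContinuousMultilinear ℝ (fun _ : Fin k => V)
      (fun _ : Fin k => ℝ) ℝ).contDiff.comp (contDiff_pi.2 ha)).clm_apply contDiff_const
  exact isBoundedLinearMap_alternatization.contDiff.comp h1

end Wedge

/-! ### The sphere parametrised by its inverse charts -/

/-- The inverse of the chart centred at `x`, as a map into `ℍ`. -/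
noncomputable def param (x : S3) (z : E3) : ℍ[ℝ] := ((extChartAt (𝓡 3) x).symm z : S3)

/-- The charts are stereographic projections, onto all of `ℝ³`. Hence `param x` is smooth everywhere
and no domain has to be tracked. -/
theorem extChartAt_sphere_target (x : S3) : (extChartAt (𝓡 3) x).target = Set.univ := by
  rw [extChartAt_target]
  simp [chartAt, ChartedSpace.chartAt]

theorem norm_param (x : S3) (z : E3) : ‖param x z‖ = 1 := by
  simp [param]

theorem contMDiff_extChartAt_symm_sphere {n : ℕ∞ω} (x : S3) :
    ContMDiff 𝓘(ℝ, E3) (𝓡 3) n (extChartAt (𝓡 3) x).symm := by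
  rw [← contMDiffOn_univ, ← extChartAt_sphere_target x]
  exact contMDiffOn_extChartAt_symm x

theorem contMDiff_incl {n : ℕ∞ω} : ContMDiff (𝓡 3) 𝓘(ℝ, ℍ[ℝ]) n incl :=
  contMDiff_coe_sphere

theorem contDiff_param {n : ℕ∞ω} (x : S3) : ContDiff ℝ n (param x) :=
  contMDiff_iff_contDiff.1 (contMDiff_incl.comp (contMDiff_extChartAt_symm_sphere x))

theorem dincl_injective (y : S3) : Function.Injective (dincl y) :=
  injective_mvfderiv_subtypeVal_sphere y

theorem range_dincl (y : S3) : (dincl y).range = (ℝ ∙ (y : ℍ[ℝ]))ᗮ :=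
  range_mvfderiv_subtypeVal (n := 3) y

/-- The chain rule for the inclusion after an inverse chart. It makes the chart representative of a
form restricted from `ℍ` an honest pullback under `param x`. -/
theorem dincl_comp_mfderiv_symm (x : S3) (z : E3) :
    (dincl ((extChartAt (𝓡 3) x).symm z)).comp
      ((mfderiv 𝓘(ℝ, E3) (𝓡 3) (extChartAt (𝓡 3) x).symm z).comp
      ((NormedSpace.fromTangentSpace (𝕜 := ℝ) z).symm : E3 →L[ℝ] TangentSpace 𝓘(ℝ, E3) z)) =
    fderiv ℝ (param x) z := by
  have h := mfderiv_comp (I := 𝓘(ℝ, E3)) (I' := 𝓡 3) (I'' := 𝓘(ℝ, ℍ[ℝ])) z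
    (g := incl) (f := (extChartAt (𝓡 3) x).symm)
    ((contMDiff_incl (n := 1)).mdifferentiableAt one_ne_zero)
    ((contMDiff_extChartAt_symm_sphere (n := 1) x).mdifferentiableAt one_ne_zero)
  rw [← mfderiv_eq_fderiv]
  exact h.symm

theorem inChart_pullback {k : ℕ} (β : ℍ[ℝ] → ℍ[ℝ] [⋀^Fin k]→L[ℝ] ℝ) (x : S3) (z : E3) :
    DForm.inChart (fun y : S3 => (β y).compContinuousLinearMap (dincl y)) x z =
      (β (param x z)).compContinuousLinearMap (fderiv ℝ (param x) z) := by
  rw [← dincl_comp_mfderiv_symm]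
  rfl

theorem fderiv_param_comp_mvfderiv_extChartAt (x : S3) :
    (fderiv ℝ (param x) (extChartAt (𝓡 3) x x)).comp (mvfderiv (𝓡 3) (extChartAt (𝓡 3) x) x) =
      dincl x := by
  have h := mfderiv_comp (I := 𝓡 3) (I' := 𝓘(ℝ, E3)) (I'' := 𝓘(ℝ, ℍ[ℝ])) x
    (g := param x) (f := extChartAt (𝓡 3) x)
    ((contDiff_param (n := 1) x).contMDiff.mdifferentiableAt one_ne_zero)
    ((contMDiffAt_extChartAt (n := 1)).mdifferentiableAt one_ne_zero)
  rw [mfderiv_eq_fderiv] at h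
  have h2 : mfderiv (𝓡 3) 𝓘(ℝ, ℍ[ℝ]) (param x ∘ extChartAt (𝓡 3) x) x =
      mfderiv (𝓡 3) 𝓘(ℝ, ℍ[ℝ]) incl x := by
    apply Filter.EventuallyEq.mfderiv_eq
    filter_upwards [extChartAt_source_mem_nhds (I := 𝓡 3) x] with y hy
    exact congrArg Subtype.val ((extChartAt (𝓡 3) x).left_inv hy)
  rw [h2] at h
  exact h.symm

theorem inner_param_fderiv (x : S3) (z w : E3) :
    inner ℝ (param x z) (fderiv ℝ (param x) z w) = 0 := by
  have h := congrArg (fun L => L w) (dincl_comp_mfderiv_symm x z)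
  have h3 : fderiv ℝ (param x) z w ∈ (ℝ ∙ (param x z))ᗮ := by
    have := range_dincl ((extChartAt (𝓡 3) x).symm z)
    rw [show param x z = (((extChartAt (𝓡 3) x).symm z : S3) : ℍ[ℝ]) from rfl, ← this]
    exact ⟨_, h⟩
  exact (Submodule.mem_orthogonal_singleton_iff_inner_right).1 h3

/-! ### Quaternion algebra of the frame and its dual -/

/-- The covectors `⟨eᵢ p, ·⟩` on `ℍ`, whose restrictions to the sphere are the dual frame. -/
noncomputable def ambientCoframe (i : Fin 3) (p : ℍ[ℝ]) : ℍ[ℝ] →L[ℝ] ℝ :=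
  (![p.re • dy 1 - p.imI • dy 0 + p.imJ • dy 3 - p.imK • dy 2,
      p.re • dy 2 - p.imJ • dy 0 + p.imK • dy 1 - p.imI • dy 3,
      p.re • dy 3 - p.imK • dy 0 + p.imI • dy 2 - p.imJ • dy 1] : Fin 3 → (ℍ[ℝ] →L[ℝ] ℝ)) i

theorem coframe_eq (i : Fin 3) (y : S3) :
    coframe i y = (ambientCoframe i y).comp (dincl y) := rfl

theorem coframe_apply (i : Fin 3) (y : S3) (u : TangentSpace (𝓡 3) y) :
    coframe i y u = ambientCoframe i y (dincl y u) := rfl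

theorem ambientCoframe_zero (p w : ℍ[ℝ]) : ambientCoframe 0 p w =
    p.re * w.imI - p.imI * w.re + p.imJ * w.imK - p.imK * w.imJ := rfl

theorem ambientCoframe_one (p w : ℍ[ℝ]) : ambientCoframe 1 p w =
    p.re * w.imJ - p.imJ * w.re + p.imK * w.imI - p.imI * w.imK := rfl

theorem ambientCoframe_two (p w : ℍ[ℝ]) : ambientCoframe 2 p w =
    p.re * w.imK - p.imK * w.re + p.imI * w.imJ - p.imJ * w.imI := rfl

theorem coords_imUnit (i : Fin 3) : (imUnit i).re = 0 ∧
    (imUnit i).imI = (if i = 0 then 1 else 0) ∧ (imUnit i).imJ = (if i = 1 then 1 else 0) ∧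
    (imUnit i).imK = if i = 2 then 1 else 0 := by
  fin_cases i <;> exact ⟨rfl, by simp [imUnit], by simp [imUnit], by simp [imUnit]⟩

theorem coords_imUnit_zero_mul (p : ℍ[ℝ]) : (imUnit 0 * p).re = -p.imI ∧
    (imUnit 0 * p).imI = p.re ∧ (imUnit 0 * p).imJ = -p.imK ∧ (imUnit 0 * p).imK = p.imJ := by
  simp [coords_imUnit]

theorem coords_imUnit_one_mul (p : ℍ[ℝ]) : (imUnit 1 * p).re = -p.imJ ∧
    (imUnit 1 * p).imI = p.imK ∧ (imUnit 1 * p).imJ = p.re ∧ (imUnit 1 * p).imK = -p.imI := by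
  simp [coords_imUnit]

theorem coords_imUnit_two_mul (p : ℍ[ℝ]) : (imUnit 2 * p).re = -p.imK ∧
    (imUnit 2 * p).imI = -p.imJ ∧ (imUnit 2 * p).imJ = p.imI ∧ (imUnit 2 * p).imK = p.re := by
  simp [coords_imUnit]

theorem sq_coords_eq_one (y : S3) : (y : ℍ[ℝ]).re ^ 2 + (y : ℍ[ℝ]).imI ^ 2 +
    (y : ℍ[ℝ]).imJ ^ 2 + (y : ℍ[ℝ]).imK ^ 2 = 1 := by
  have h : ‖(y : ℍ[ℝ])‖ = 1 := by simp
  rw [← Quaternion.normSq_def', Quaternion.normSq_eq_norm_mul_self, h, one_mul]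

theorem ambientCoframe_imUnit_mul (i j : Fin 3) (y : S3) :
    ambientCoframe i y (imUnit j * y) = if i = j then 1 else 0 := by
  have h := sq_coords_eq_one y
  fin_cases i <;> fin_cases j <;> try simp [-Quaternion.re_mul, -Quaternion.imI_mul, -Quaternion.imJ_mul, -Quaternion.imK_mul,
      ambientCoframe_zero, ambientCoframe_one, ambientCoframe_two, coords_imUnit_zero_mul,
      coords_imUnit_one_mul, coords_imUnit_two_mul] <;> ring_nf
  all_goals linear_combination h

theorem coframe_stdFrame (i j : Fin 3) (y : S3) :
    coframe i y (stdFrame j y) = if i = j then 1 else 0 := by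
  rw [coframe_apply, dincl_stdFrame, ambientCoframe_imUnit_mul]

/-- The vectors `y, i y, j y, k y` are orthonormal in `ℍ`, so a vector orthogonal to `y` is the sum
of its projections on the last three. Coordinatewise only `|y|² = 1` and `⟨y, w⟩ = 0` are needed. -/
theorem sum_ambientCoframe_smul (y : S3) {w : ℍ[ℝ]} (hw : inner ℝ (y : ℍ[ℝ]) w = 0) :
    ∑ i, ambientCoframe i y w • (imUnit i * (y : ℍ[ℝ])) = w := by
  have h := sq_coords_eq_one y
  rw [Quaternion.inner_def] at hw
  simp only [Quaternion.re_mul, Quaternion.re_star, Quaternion.imI_star, Quaternion.imJ_star,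
    Quaternion.imK_star] at hw
  rw [Fin.sum_univ_three, ambientCoframe_zero, ambientCoframe_one, ambientCoframe_two]
  apply Quaternion.ext
  · simp [coords_imUnit]
    linear_combination w.re * h - (y : ℍ[ℝ]).re * hw
  · simp [coords_imUnit]
    linear_combination w.imI * h - (y : ℍ[ℝ]).imI * hw
  · simp [coords_imUnit]
    linear_combination w.imJ * h - (y : ℍ[ℝ]).imJ * hw
  · simp [coords_imUnit]
    linear_combination w.imK * h - (y : ℍ[ℝ]).imK * hw

theorem inner_dincl (y : S3) (u : TangentSpace (𝓡 3) y) : inner ℝ (y : ℍ[ℝ]) (dincl y u) = 0 := by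
  have h : dincl y u ∈ (ℝ ∙ (y : ℍ[ℝ]))ᗮ := by
    rw [← range_dincl]
    exact ⟨u, rfl⟩
  exact Submodule.mem_orthogonal_singleton_iff_inner_right.1 h

theorem sum_coframe_smul_stdFrame (y : S3) (u : TangentSpace (𝓡 3) y) :
    ∑ i, coframe i y u • stdFrame i y = u := by
  apply dincl_injective
  rw [map_sum]
  simp only [map_smul, dincl_stdFrame]
  exact sum_ambientCoframe_smul y (inner_dincl y u)

/-- The standard frame as a basis of the tangent space. -/
noncomputable def stdBasis (y : S3) : Module.Basis (Fin 3) ℝ (TangentSpace (𝓡 3) y) :=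
  Module.Basis.mk (v := fun i => stdFrame i y)
    (Fintype.linearIndependent_iff.2 fun g hg i => by
      simpa [coframe_stdFrame] using congrArg (coframe i y) hg)
    fun u _ => by
      rw [← sum_coframe_smul_stdFrame y u]
      exact Submodule.sum_mem _ fun i _ =>
        Submodule.smul_mem _ _ (Submodule.subset_span ⟨i, rfl⟩)

theorem stdBasis_apply (y : S3) (i : Fin 3) : stdBasis y i = stdFrame i y := by
  simp [stdBasis]

theorem dvol_stdFrame (y : S3) : dvol y (fun i => stdFrame i y) = 1 := by
  have h := sq_coords_eq_one y
  simp only [dvol, ContinuousAlternatingMap.compContinuousLinearMap_apply,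
    ContinuousAlternatingMap.sub_apply, ContinuousAlternatingMap.smul_apply, wedge_apply,
    Matrix.det_fin_three, Function.comp_apply, Matrix.of_apply, dincl_stdFrame]
  simp [dy_zero, dy_one, dy_two, dy_three, coords_imUnit]
  generalize (y : ℍ[ℝ]).re = a at *
  generalize (y : ℍ[ℝ]).imI = b at *
  generalize (y : ℍ[ℝ]).imJ = c at *
  generalize (y : ℍ[ℝ]).imK = d at *
  -- With `N = |y|²` the left side is `N²`, the determinant of `(y, i y, j y, k y)`, and `N² - 1 =
  -- (N + 1)(N - 1)`.
  linear_combination (a ^ 2 + b ^ 2 + c ^ 2 + d ^ 2 + 1) * h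

theorem continuousAlternatingMap_ext_basis {y : S3} {k : ℕ}
    {η ζ : TangentSpace (𝓡 3) y [⋀^Fin k]→L[ℝ] ℝ}
    (h : ∀ s : Fin k → Fin 3, Function.Injective s →
      η (fun i => stdFrame (s i) y) = ζ (fun i => stdFrame (s i) y)) : η = ζ := by
  apply ContinuousAlternatingMap.toAlternatingMap_injective
  refine Module.Basis.ext_alternating (stdBasis y) fun s hs => ?_
  simpa [stdBasis_apply] using h s hs

/-- Both sides are top degree forms taking the value `1` on the frame; on any other injective choice
of frame vectors both change by the same sign. -/
theorem dvol_eq (y : S3) : dvol y = wedge fun i => coframe i y := by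
  refine continuousAlternatingMap_ext_basis fun s hs => ?_
  obtain ⟨σ, rfl⟩ : ∃ σ : Equiv.Perm (Fin 3), s = σ :=
    ⟨Equiv.ofBijective s (Finite.injective_iff_bijective.1 hs), rfl⟩
  have h1 := (dvol y).toAlternatingMap.map_perm (fun i => stdFrame i y) σ
  have h2 := (wedge fun i => coframe i y).toAlternatingMap.map_perm (fun i => stdFrame i y) σ
  refine h1.trans (Eq.trans ?_ h2.symm)
  congr 1
  refine (dvol_stdFrame y).trans ?_
  refine Eq.symm ((wedge_apply _ _).trans ?_)
  simp only [coframe_stdFrame]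
  exact Matrix.det_one

theorem interior_stdFrame_dvol (i : Fin 3) :
    DForm.interior (stdFrame i) dvol = coframeWedge (i + 1) (i + 2) := by
  funext y
  ext w
  rw [DForm.interior_apply, dvol_eq, wedge_apply, coframeWedge, wedge_apply]
  rw [Matrix.det_fin_three, Matrix.det_fin_two]
  fin_cases i <;> simp [coframe_stdFrame] <;> ring

theorem isNormal_stdFrame : IsNormal dvol stdFrame := dvol_stdFrame

theorem isNormal_scaledFrame : IsNormal dvol scaledFrame := by
  intro y
  refine (ContinuousAlternatingMap.map_smul_univ (dvol y) _ _).trans ?_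
  rw [dvol_stdFrame, Fin.prod_univ_three]
  -- The exponents `2/3`, `-1/3`, `-1/3` sum to zero, and the two minus signs cancel.
  have h2 : (2 : ℝ) ^ (2 / 3 : ℝ) * ((2 : ℝ) ^ (-(1 / 3) : ℝ) * (2 : ℝ) ^ (-(1 / 3) : ℝ)) = 1 := by
    rw [← Real.rpow_add two_pos, ← Real.rpow_add two_pos]
    norm_num
  simp only [Matrix.cons_val]
  linear_combination h2

theorem ambientCoframe_eq_inner (i : Fin 3) (p w : ℍ[ℝ]) :
    ambientCoframe i p w = inner ℝ (imUnit i * p) w := by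
  rw [Quaternion.inner_def]
  fin_cases i <;>
    simp [ambientCoframe_zero, ambientCoframe_one, ambientCoframe_two, coords_imUnit] <;> ring

/-! ### Exterior derivatives of the coframe -/

/-- The representative of `αᵢ` in the chart centred at `x`. -/
noncomputable def chartCoframe (x : S3) (i : Fin 3) (z : E3) : E3 →L[ℝ] ℝ :=
  (ambientCoframe i (param x z)).comp (fderiv ℝ (param x) z)

theorem chartCoframe_apply (x : S3) (i : Fin 3) (z w : E3) :
    chartCoframe x i z w = inner ℝ (imUnit i * param x z) (fderiv ℝ (param x) z w) :=
  ambientCoframe_eq_inner _ _ _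

theorem contDiff_chartCoframe {n : ℕ∞} (x : S3) (i : Fin 3) :
    ContDiff ℝ n (chartCoframe x i) := by
  rw [contDiff_clm_apply_iff]
  intro w
  simp only [chartCoframe_apply]
  exact (contDiff_const.mul (contDiff_param x)).inner ℝ
    (((contDiff_param (n := ω) x).fderiv_right le_top).clm_apply contDiff_const)

theorem inChart_wedge_coframe {k : ℕ} (s : Fin k → Fin 3) (x : S3) (z : E3) :
    DForm.inChart (fun y => wedge fun i => coframe (s i) y) x z =
      wedge fun i => chartCoframe x (s i) z := by
  have h : (fun y : S3 => wedge fun i => coframe (s i) y) = fun y : S3 =>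
      (wedge fun i => ambientCoframe (s i) y).compContinuousLinearMap (dincl y) := by
    funext y
    rw [wedge_compContinuousLinearMap]
    rfl
  rw [h, inChart_pullback fun p => wedge fun i => ambientCoframe (s i) p,
    wedge_compContinuousLinearMap]
  rfl

theorem dvol_inChart (x : S3) (z : E3) : dvol.inChart x z = wedge fun i => chartCoframe x i z := by
  rw [show dvol = _ from funext dvol_eq]
  exact inChart_wedge_coframe id x z

theorem coframeForm_inChart (i : Fin 3) (x : S3) (z : E3) :
    (coframeForm i).inChart x z = wedge ![chartCoframe x i z] := by
  have h := inChart_wedge_coframe (k := 1) ![i] x z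
  have h1 (y : S3) : (fun j => coframe (![i] j) y) = ![coframe i y] := by
    funext j; fin_cases j; rfl
  have h2 : (fun j => chartCoframe x (![i] j) z) = ![chartCoframe x i z] := by
    funext j; fin_cases j; rfl
  simp only [h1, h2] at h
  exact h

theorem coframeWedge_inChart (i j : Fin 3) (x : S3) (z : E3) :
    (coframeWedge i j).inChart x z = wedge ![chartCoframe x i z, chartCoframe x j z] := by
  have h := inChart_wedge_coframe (k := 2) ![i, j] x z
  have h1 (y : S3) : (fun l => coframe (![i, j] l) y) = ![coframe i y, coframe j y] := by
    funext l; fin_cases l <;> rfl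
  have h2 : (fun l => chartCoframe x (![i, j] l) z) =
      ![chartCoframe x i z, chartCoframe x j z] := by
    funext l; fin_cases l <;> rfl
  simp only [h1, h2] at h
  exact h

theorem isVolumeForm_dvol : IsVolumeForm dvol := by
  refine ⟨fun x => ContDiff.contDiffOn ?_, fun y h => ?_⟩
  · rw [show dvol.inChart x = _ from funext (dvol_inChart x)]
    exact contDiff_wedge (contDiff_chartCoframe x)
  · simpa [h] using dvol_stdFrame y

theorem fderiv_chartCoframe_apply (x : S3) (i : Fin 3) (z v w : E3) :
    fderiv ℝ (fun z => chartCoframe x i z w) z v =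
      inner ℝ (imUnit i * fderiv ℝ (param x) z v) (fderiv ℝ (param x) z w) +
      inner ℝ (imUnit i * param x z) (fderiv ℝ (fderiv ℝ (param x)) z v w) := by
  simp only [chartCoframe_apply]
  have h1 : HasFDerivAt (param x) (fderiv ℝ (param x) z) z :=
    ((contDiff_param (n := 1) x).differentiable one_ne_zero z).hasFDerivAt
  have h2 : HasFDerivAt (fderiv ℝ (param x)) (fderiv ℝ (fderiv ℝ (param x)) z) z :=
    (((contDiff_param (n := 2) x).fderiv_right (m := 1) le_rfl).differentiable one_ne_zero
      z).hasFDerivAt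
  have h3 := (h1.const_mul (imUnit i)).inner ℝ (h2.clm_apply (hasFDerivAt_const w z))
  rw [h3.fderiv]
  simp [add_comm]

/-- Of the derivative of `⟨eᵢ p, dp(w)⟩` only the part where `eᵢ p` is differentiated survives
antisymmetrisation: the other part contains the symmetric second derivative of `p`. -/
theorem extDeriv_wedge_chartCoframe (x : S3) (i : Fin 3) (z : E3) (w : Fin 2 → E3) :
    extDeriv (fun z => wedge ![chartCoframe x i z]) z w =
      inner ℝ (imUnit i * fderiv ℝ (param x) z (w 0)) (fderiv ℝ (param x) z (w 1)) -
      inner ℝ (imUnit i * fderiv ℝ (param x) z (w 1)) (fderiv ℝ (param x) z (w 0)) := by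
  have hd : ContDiff ℝ 1 fun z => wedge ![chartCoframe x i z] :=
    contDiff_wedge fun j => by
      fin_cases j
      exact contDiff_chartCoframe (n := 1) x i
  have hs : IsSymmSndFDerivAt ℝ (param x) z :=
    (contDiff_param (n := 2) x).contDiffAt.isSymmSndFDerivAt (by simp)
  rw [extDeriv_apply (hd.differentiable one_ne_zero z)]
  simp only [wedge_apply, Matrix.det_unique]
  have e0 : Fin.tail w 0 = w 1 := rfl
  have e1 : Fin.removeNth 1 w 0 = w 0 := rfl
  simp [Fin.sum_univ_two, e0, e1, fderiv_chartCoframe_apply, hs.eq (w 1) (w 0)]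
  ring

/-- Left multiplication by `eᵢ` sends `eᵢ₊₁ y` to `eᵢ₊₂ y`, `eᵢ₊₂ y` to `-eᵢ₊₁ y`, and `eᵢ y` to the
normal vector `-y`. So in frame coordinates each inner product on the left is, up to sign, the same
`2 × 2` minor. -/
theorem inner_imUnit_mul_sub (i : Fin 3) (y : S3) {u v : ℍ[ℝ]} (hu : inner ℝ (y : ℍ[ℝ]) u = 0)
    (hv : inner ℝ (y : ℍ[ℝ]) v = 0) :
    inner ℝ (imUnit i * u) v - inner ℝ (imUnit i * v) u =
      2 * (ambientCoframe (i + 1) y u * ambientCoframe (i + 2) y v -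
        ambientCoframe (i + 2) y u * ambientCoframe (i + 1) y v) := by
  have h := sq_coords_eq_one y
  rw [← sum_ambientCoframe_smul y hu, ← sum_ambientCoframe_smul y hv]
  simp only [map_sum, map_smul, ambientCoframe_imUnit_mul]
  generalize ha : (fun i => ambientCoframe i y u) = a
  generalize hb : (fun i => ambientCoframe i y v) = b
  simp only [fun i => show ambientCoframe i y u = a i from congrFun ha i,
    fun i => show ambientCoframe i y v = b i from congrFun hb i, Fin.sum_univ_three,
    Quaternion.inner_def]
  clear hu hv ha hb
  generalize (y : ℍ[ℝ]) = p at *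
  fin_cases i
  · simp [coords_imUnit]
    linear_combination 2 * (a 1 * b 2 - a 2 * b 1) * h
  · simp [coords_imUnit]
    linear_combination 2 * (a 2 * b 0 - a 0 * b 2) * h
  · simp [coords_imUnit]
    linear_combination 2 * (a 0 * b 1 - a 1 * b 0) * h

theorem extDeriv_coframeForm_inChart (i : Fin 3) (x : S3) (z : E3) :
    extDeriv ((coframeForm i).inChart x) z =
      (2 : ℝ) • (coframeWedge (i + 1) (i + 2)).inChart x z := by
  ext w
  rw [show (coframeForm i).inChart x = _ from funext (coframeForm_inChart i x),
    extDeriv_wedge_chartCoframe, coframeWedge_inChart, ContinuousAlternatingMap.smul_apply,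
    wedge_apply, Matrix.det_fin_two]
  refine (inner_imUnit_mul_sub i ((extChartAt (𝓡 3) x).symm z) (inner_param_fderiv x z _)
    (inner_param_fderiv x z _)).trans ?_
  simp only [smul_eq_mul, Matrix.of_apply, Matrix.cons_val]
  change _ = 2 * (chartCoframe x (i + 1) z (w 0) * chartCoframe x (i + 2) z (w 1) -
    chartCoframe x (i + 1) z (w 1) * chartCoframe x (i + 2) z (w 0))
  simp only [chartCoframe, ContinuousLinearMap.comp_apply]
  rw [show param x z = (((extChartAt (𝓡 3) x).symm z : S3) : ℍ[ℝ]) from rfl]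
  ring

/-- Passing to the chart centred at `x` and pulling back at `x` loses nothing, since `dp` after the
differential of the chart is `dincl x`. -/
theorem coframeWedge_inChart_comp (i j : Fin 3) (x : S3) :
    ((coframeWedge i j).inChart x (extChartAt (𝓡 3) x x)).compContinuousLinearMap
      (mvfderiv (𝓡 3) (extChartAt (𝓡 3) x) x) = coframeWedge i j x := by
  have hp : param x (extChartAt (𝓡 3) x x) = x := by
    simp only [param, extChartAt_to_inv]
  have hc (l : Fin 3) : (chartCoframe x l (extChartAt (𝓡 3) x x)).comp
      (mvfderiv (𝓡 3) (extChartAt (𝓡 3) x) x) = coframe l x := by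
    rw [coframe_eq, ← fderiv_param_comp_mvfderiv_extChartAt, chartCoframe, hp]
    rfl
  rw [coframeWedge_inChart, wedge_compContinuousLinearMap, coframeWedge, ← hc i, ← hc j]
  congr 1
  funext l
  fin_cases l <;> rfl

theorem d_coframeForm (i : Fin 3) :
    (coframeForm i).d = (2 : ℝ) • coframeWedge (i + 1) (i + 2) := by
  funext x
  rw [DForm.d, extDeriv_coframeForm_inChart, Pi.smul_apply, ← coframeWedge_inChart_comp]
  rfl

theorem d_interior_stdFrame (i : Fin 3) : (DForm.interior (stdFrame i) dvol).d = 0 := by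
  funext x
  -- The identity holds on the whole chart, not just at `x`, so it may be differentiated again and
  -- `d ∘ d = 0` applies.
  have h : (coframeWedge (i + 1) (i + 2)).inChart x =
      (1 / 2 : ℝ) • extDeriv ((coframeForm i).inChart x) := by
    funext z
    rw [Pi.smul_apply, extDeriv_coframeForm_inChart, smul_smul]
    norm_num
  have hc : ContDiff ℝ 2 ((coframeForm i).inChart x) := by
    rw [show (coframeForm i).inChart x = _ from funext (coframeForm_inChart i x)]
    exact contDiff_wedge fun j => by
      fin_cases j
      exact contDiff_chartCoframe (n := 2) x i
  rw [interior_stdFrame_dvol, DForm.d, h, extDeriv_smul, extDeriv_extDeriv hc (by simp)]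
  ext w
  simp

theorem interior_smul {k : ℕ} (c : ℝ) (u : VField S3) (η : DForm S3 (k + 1)) :
    DForm.interior (c • u) η = c • DForm.interior u η := by
  funext x
  ext w
  rw [DForm.interior_apply]
  exact (η x).toAlternatingMap.map_vecCons_smul w c (u x)

theorem d_smul {k : ℕ} (c : ℝ) (η : DForm S3 k) : (c • η).d = c • η.d := by
  have h (x : S3) : (c • η).inChart x = c • η.inChart x := rfl
  funext x
  rw [DForm.d, h, extDeriv_smul]
  rfl

/-! ### The flows of the frame and smoothness of the fields -/

/-- The unit quaternion `exp (t eᵢ)`. -/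
noncomputable def expUnit (i : Fin 3) (t : ℝ) : ℍ[ℝ] := Real.cos t • 1 + Real.sin t • imUnit i

theorem norm_expUnit (i : Fin 3) (t : ℝ) : ‖expUnit i t‖ = 1 := by
  have h : ‖expUnit i t‖ * ‖expUnit i t‖ = 1 := by
    rw [← Quaternion.normSq_eq_norm_mul_self, Quaternion.normSq_def']
    have := Real.cos_sq_add_sin_sq t
    fin_cases i <;> simp [expUnit, coords_imUnit]
  nlinarith [norm_nonneg (expUnit i t)]

theorem expUnit_zero (i : Fin 3) : expUnit i 0 = 1 := by simp [expUnit]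

theorem imUnit_mul_self (i : Fin 3) : imUnit i * imUnit i = -1 := by
  fin_cases i <;> apply Quaternion.ext <;> simp [coords_imUnit]

theorem hasDerivAt_expUnit (i : Fin 3) (t : ℝ) :
    HasDerivAt (expUnit i) (imUnit i * expUnit i t) t := by
  have h := ((Real.hasDerivAt_cos t).smul_const (1 : ℍ[ℝ])).add
    ((Real.hasDerivAt_sin t).smul_const (imUnit i))
  convert! h using 1
  simp only [expUnit, mul_add, mul_smul_comm, mul_one, imUnit_mul_self, smul_neg, neg_smul]
  abel

theorem contDiff_expUnit (i : Fin 3) {n : ℕ∞ω} : ContDiff ℝ n (expUnit i) :=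
  (Real.contDiff_cos.smul contDiff_const).add (Real.contDiff_sin.smul contDiff_const)

/-- The flow `y ↦ exp (t eᵢ) y` of the field `eᵢ y` on the sphere. -/
noncomputable def rotate (i : Fin 3) (t : ℝ) (y : S3) : S3 :=
  ⟨expUnit i t * y, by simp [norm_expUnit]⟩

theorem rotate_zero (i : Fin 3) (y : S3) : rotate i 0 y = y :=
  Subtype.ext (by simp [rotate, expUnit_zero])

theorem contMDiff_rotate (i : Fin 3) {n : ℕ∞ω} :
    ContMDiff ((𝓡 3).prod 𝓘(ℝ, ℝ)) (𝓡 3) n fun q : S3 × ℝ => rotate i q.2 q.1 := by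
  have h1 : ContMDiff ((𝓡 3).prod 𝓘(ℝ, ℝ)) 𝓘(ℝ, ℍ[ℝ]) n
      fun q : S3 × ℝ => expUnit i q.2 :=
    (contDiff_expUnit i).contMDiff.comp contMDiff_snd
  have h2 : ContMDiff ((𝓡 3).prod 𝓘(ℝ, ℝ)) 𝓘(ℝ, ℍ[ℝ]) n fun q : S3 × ℝ => incl q.1 :=
    contMDiff_incl.comp contMDiff_fst
  have h3 : ContMDiff (𝓘(ℝ, ℍ[ℝ]).prod 𝓘(ℝ, ℍ[ℝ])) 𝓘(ℝ, ℍ[ℝ]) n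
      fun p : ℍ[ℝ] × ℍ[ℝ] => p.1 * p.2 := by
    rw [contMDiff_iff]
    exact ⟨continuous_mul, fun x y => contDiff_mul.contDiffOn⟩
  exact (h3.comp (h1.prodMk h2)).codRestrict_sphere fun q => (rotate i q.2 q.1).2

theorem tangentBundle_sphere_ext {P Q : TangentBundle (𝓡 3) S3} (h : P.proj = Q.proj)
    (h2 : dincl P.proj P.snd = dincl Q.proj Q.snd) : P = Q := by
  obtain ⟨p, u⟩ := P
  obtain ⟨q, v⟩ := Q
  obtain rfl : p = q := h
  obtain rfl : u = v := dincl_injective p h2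
  rfl

-- The field is defined pointwise by choice, so smoothness comes from exhibiting it as the velocity
-- of a smooth flow: the tangent map of `(y, t) ↦ exp (t eᵢ) y` applied to the smooth section `(0,
-- ∂ₜ)` over `t = 0`. The two agree because `dincl` is injective.
open Bundle in
theorem smoothField_stdFrame (i : Fin 3) : SmoothField (stdFrame i) := by
  let F₁ : S3 → TangentBundle (𝓡 3) S3 × TangentBundle 𝓘(ℝ, ℝ) ℝ :=
    fun y => (TotalSpace.mk' E3 y 0, TotalSpace.mk' ℝ (0 : ℝ) (1 : ℝ))
  have S₁ : ContMDiff (𝓡 3) ((𝓡 3).tangent.prod 𝓘(ℝ, ℝ).tangent) ∞ F₁ :=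
    (contMDiff_zeroSection _ _).prodMk contMDiff_const
  have S₂ := contMDiff_equivTangentBundleProd_symm (n := ∞) (I := 𝓡 3) (M := S3)
    (I' := 𝓘(ℝ, ℝ)) (M' := ℝ)
  have S₃ := (contMDiff_rotate i (n := ∞)).contMDiff_tangentMap (m := ∞) le_rfl
  have S := (S₃.comp S₂).comp S₁
  unfold SmoothField
  convert! S using 1
  funext y
  refine tangentBundle_sphere_ext (rotate_zero i y).symm ?_
  have hG : MDifferentiableAt ((𝓡 3).prod 𝓘(ℝ, ℝ)) (𝓡 3)
      (fun q : S3 × ℝ => rotate i q.2 q.1) (y, 0) :=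
    (contMDiff_rotate i (n := 1)).mdifferentiableAt one_ne_zero
  have h1 : (tangentMap ((𝓡 3).prod 𝓘(ℝ, ℝ)) (𝓡 3) (fun q : S3 × ℝ => rotate i q.2 q.1)
      ((equivTangentBundleProd (𝓡 3) S3 𝓘(ℝ, ℝ) ℝ).symm (F₁ y))).snd =
      mfderiv 𝓘(ℝ, ℝ) (𝓡 3) (fun t => rotate i t y) 0 (1 : ℝ) := by
    refine (mfderiv_prod_eq_add_apply hG (v := ((0 : E3), (1 : ℝ)))).trans ?_
    simp only [add_eq_right]
    exact map_zero (mfderiv (𝓡 3) (𝓡 3) (fun z => rotate i 0 z) y)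
  have h2 := mfderiv_comp_apply (I := 𝓘(ℝ, ℝ)) (I' := 𝓡 3) (I'' := 𝓘(ℝ, ℍ[ℝ])) (0 : ℝ)
    (g := incl) (f := fun t => rotate i t y)
    ((contMDiff_incl (n := 1)).mdifferentiableAt one_ne_zero)
    (((contMDiff_rotate i (n := 1)).comp
      (contMDiff_const.prodMk contMDiff_id)).mdifferentiableAt one_ne_zero) (1 : ℝ)
  rw [mfderiv_eq_fderiv] at h2
  have h3 : fderiv ℝ (incl ∘ fun t => rotate i t y) 0 (1 : ℝ) = imUnit i * (y : ℍ[ℝ]) := by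
    have := (hasDerivAt_expUnit i 0).mul_const (y : ℍ[ℝ])
    rw [expUnit_zero, mul_one] at this
    exact this.deriv
  rw [dincl_stdFrame, ← h3]
  refine h2.trans ?_
  exact congrArg _ h1.symm

/-! ### Brackets of the frame fields -/

/-- The representative of a vector field in the chart centred at `x`. -/
noncomputable def chartField (V : VField S3) (x : S3) (z : E3) : E3 :=
  VectorField.mpullbackWithin 𝓘(ℝ, E3) (𝓡 3) (extChartAt (𝓡 3) x).symm V
    (Set.range (𝓡 3)) z

theorem fderiv_param_chartField (V : VField S3) (x : S3) (z : E3) :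
    fderiv ℝ (param x) z (chartField V x z) =
      dincl ((extChartAt (𝓡 3) x).symm z) (V ((extChartAt (𝓡 3) x).symm z)) := by
  have h := isInvertible_mfderivWithin_extChartAt_symm (I := 𝓡 3) (x := x) (y := z)
    (by rw [extChartAt_sphere_target]; trivial)
  rw [← dincl_comp_mfderiv_symm]
  have h2 : mfderivWithin 𝓘(ℝ, E3) (𝓡 3) (extChartAt (𝓡 3) x).symm (Set.range (𝓡 3)) z =
      mfderiv 𝓘(ℝ, E3) (𝓡 3) (extChartAt (𝓡 3) x).symm z := by
    rw [modelWithCornersSelf_coe, Set.range_id, mfderivWithin_univ]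
  change dincl _ (mfderiv 𝓘(ℝ, E3) (𝓡 3) (extChartAt (𝓡 3) x).symm z (chartField V x z)) = _
  congr 1
  rw [← h2, chartField, VectorField.mpullbackWithin_apply]
  exact h.self_apply_inverse _

theorem differentiableAt_chartField {V : VField S3} (hV : SmoothField V) (x : S3) :
    DifferentiableAt ℝ (chartField V x) (extChartAt (𝓡 3) x x) := by
  have h := VectorField.contMDiffWithinAt_mpullbackWithin_extChartAt_symm (I := 𝓡 3) (n := ω)
    (m := 1) (s := Set.univ) (V := V) (x := x) ((hV x).of_le (by simp)).contMDiffWithinAt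
    uniqueMDiffOn_univ trivial
    le_top
  rw [extChartAt_sphere_target, Set.preimage_univ, Set.univ_inter, contMDiffWithinAt_univ,
    contMDiffAt_vectorSpace_iff_contDiffAt] at h
  exact h.differentiableAt one_ne_zero

theorem fderiv_param_fderiv_chartField (i : Fin 3) (x : S3) (v : E3) :
    fderiv ℝ (param x) (extChartAt (𝓡 3) x x)
        (fderiv ℝ (chartField (stdFrame i) x) (extChartAt (𝓡 3) x x) v) =
      imUnit i * fderiv ℝ (param x) (extChartAt (𝓡 3) x x) v -
      fderiv ℝ (fderiv ℝ (param x)) (extChartAt (𝓡 3) x x) v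
        (chartField (stdFrame i) x (extChartAt (𝓡 3) x x)) := by
  set z := extChartAt (𝓡 3) x x
  have h1 : HasFDerivAt (param x) (fderiv ℝ (param x) z) z :=
    ((contDiff_param (n := 1) x).differentiable one_ne_zero z).hasFDerivAt
  have h2 : HasFDerivAt (fderiv ℝ (param x)) (fderiv ℝ (fderiv ℝ (param x)) z) z :=
    (((contDiff_param (n := 2) x).fderiv_right (m := 1) le_rfl).differentiable one_ne_zero
      z).hasFDerivAt
  have h3 := h2.clm_apply (differentiableAt_chartField (smoothField_stdFrame i) x).hasFDerivAt
  -- The relation `dp(X) = eᵢ p` holds at every `z`; differentiating it in the direction `v` gives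
  -- the claim.
  have h4 : (fun z => fderiv ℝ (param x) z (chartField (stdFrame i) x z)) =
      fun z => imUnit i * param x z := by
    funext z
    rw [fderiv_param_chartField, dincl_stdFrame]
    rfl
  rw [h4] at h3
  have h5 := congrArg (fun L => L v) (h3.unique (h1.const_mul (imUnit i)))
  simp at h5
  rw [← h5]
  abel

/-- In the chart the bracket is `dXⱼ(Xᵢ) - dXᵢ(Xⱼ)`. Applying `dp` to it, the second derivatives of
`p` cancel by symmetry and the terms `eⱼ eᵢ x - eᵢ eⱼ x` remain. -/
theorem dincl_mlieBracket_stdFrame (i j : Fin 3) (x : S3) :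
    dincl x (VectorField.mlieBracket (𝓡 3) (stdFrame i) (stdFrame j) x) =
      (imUnit j * imUnit i - imUnit i * imUnit j) * (x : ℍ[ℝ]) := by
  set z := extChartAt (𝓡 3) x x with hz
  have hs : IsSymmSndFDerivAt ℝ (param x) z :=
    (contDiff_param (n := 2) x).contDiffAt.isSymmSndFDerivAt (by simp)
  have hp : param x z = x := by
    simp only [hz, param, extChartAt_to_inv]
  have hf (l : Fin 3) : fderiv ℝ (param x) z (chartField (stdFrame l) x z) =
      imUnit l * (x : ℍ[ℝ]) := by
    rw [fderiv_param_chartField, dincl_stdFrame, ← hp]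
    rfl
  have h1 : dincl x (VectorField.mlieBracket (𝓡 3) (stdFrame i) (stdFrame j) x) =
      fderiv ℝ (param x) z (VectorField.lieBracket ℝ (chartField (stdFrame i) x)
        (chartField (stdFrame j) x) z) := by
    rw [← fderiv_param_comp_mvfderiv_extChartAt, ← VectorField.lieBracketWithin_univ]
    change fderiv ℝ (param x) z (mfderiv (𝓡 3) 𝓘(ℝ, E3) (extChartAt (𝓡 3) x) x _) = _
    congr 1
    rw [← VectorField.mlieBracketWithin_univ, VectorField.mlieBracketWithin_apply]
    refine ((isInvertible_mfderiv_extChartAt (mem_extChartAt_source x)).self_apply_inverse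
      _).trans ?_
    rw [Set.preimage_univ, Set.univ_inter]
    change VectorField.lieBracketWithin ℝ (chartField (stdFrame i) x) (chartField (stdFrame j) x)
      (Set.range (𝓡 3)) z = _
    rw [modelWithCornersSelf_coe, Set.range_id]
  rw [h1, VectorField.lieBracket, map_sub, fderiv_param_fderiv_chartField,
    fderiv_param_fderiv_chartField, hf, hf, hs.eq]
  noncomm_ring

theorem imUnit_commutator (i : Fin 3) :
    imUnit (i + 1) * imUnit (i + 2) - imUnit (i + 2) * imUnit (i + 1) = (2 : ℝ) • imUnit i := by
  fin_cases i <;> apply Quaternion.ext <;> simp [coords_imUnit] <;> norm_num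

theorem bracket_stdFrame (i : Fin 3) :
    bracket (stdFrame (i + 1)) (stdFrame (i + 2)) = (2 : ℝ) • stdFrame i := by
  funext x
  apply dincl_injective
  rw [bracket, map_neg, dincl_mlieBracket_stdFrame, Pi.smul_apply, map_smul, dincl_stdFrame,
    ← smul_mul_assoc, ← imUnit_commutator]
  noncomm_ring

/-! ### Both frames are divergence free, and the rescaled one is singular -/

theorem isDivFreeFrame_stdFrame : IsDivFreeFrame dvol stdFrame where
  smooth := smoothField_stdFrame
  divFree := d_interior_stdFrame
  positive x := (isNormal_stdFrame x).symm ▸ one_pos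

theorem smoothField_const_smul (c : ℝ) {V : VField S3} (hV : SmoothField V) :
    SmoothField (c • V) :=
  ContMDiff.const_smul_section hV

theorem isDivFreeFrame_scaledFrame : IsDivFreeFrame dvol scaledFrame where
  smooth i := smoothField_const_smul _ (smoothField_stdFrame i)
  divFree i := by
    refine (congrArg DForm.d (interior_smul _ (stdFrame i) dvol)).trans ?_
    rw [d_smul, d_interior_stdFrame, smul_zero]
  positive x := (isNormal_scaledFrame x).symm ▸ one_pos

theorem fueter_scaledFrame_incl (y : S3) : fueter scaledFrame incl y = 0 := by
  have h (i : Fin 3) : dirDeriv (scaledFrame i) incl y =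
      (![(2 : ℝ) ^ (2 / 3 : ℝ), -(2 : ℝ) ^ (-(1 / 3) : ℝ), -(2 : ℝ) ^ (-(1 / 3) : ℝ)] :
        Fin 3 → ℝ) i • (imUnit i * (y : ℍ[ℝ])) := by
    rw [← dincl_stdFrame]
    exact (dincl y).map_smul _ _
  -- This says that the three weights sum to zero; as `eᵢ eᵢ = -1`, the Fueter operator gives `-(c₁
  -- + c₂ + c₃) y`.
  have h2 : (2 : ℝ) ^ (2 / 3 : ℝ) = 2 * (2 : ℝ) ^ (-(1 / 3) : ℝ) := by
    conv_rhs => rw [← Real.rpow_one 2, ← Real.rpow_mul two_pos.le, ← Real.rpow_add two_pos]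
    norm_num
  simp only [fueter, h, Fin.sum_univ_three, mul_smul_comm, ← mul_assoc, imUnit_mul_self,
    Matrix.cons_val, h2]
  module

theorem not_constant_incl : ¬ ∃ c, ∀ y, incl y = c := by
  rintro ⟨c, hc⟩
  have h := (hc ⟨1, by simp⟩).trans (hc ⟨-1, by simp⟩).symm
  have := congrArg (fun q : ℍ[ℝ] => q.re) h
  simp [incl] at this
  norm_num at this

theorem isSingularFrame_scaledFrame : IsSingularFrame dvol scaledFrame :=
  ⟨isDivFreeFrame_scaledFrame, fun h =>
    not_constant_incl (h incl contMDiff_incl fueter_scaledFrame_incl)⟩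

/-! ### Radial extension of functions to `ℍ` minus the origin -/

open Classical in
/-- The radial projection `ℍ → S³`, with a junk value at the origin. -/
noncomputable def radial (x : ℍ[ℝ]) : S3 :=
  if h : x = 0 then ⟨1, by simp⟩ else ⟨‖x‖⁻¹ • x, by simp [norm_smul, h]⟩

theorem radial_coe (y : S3) : radial y = y := by
  have h : (y : ℍ[ℝ]) ≠ 0 := ne_zero_of_mem_unit_sphere y
  ext1
  simp [radial, h]

theorem contMDiffAt_radial {n : ℕ∞ω} {x : ℍ[ℝ]} (hx : x ≠ 0) :
    ContMDiffAt 𝓘(ℝ, ℍ[ℝ]) (𝓡 3) n radial x := by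
  let U : TopologicalSpace.Opens ℍ[ℝ] := ⟨{0}ᶜ, isOpen_compl_singleton⟩
  have h : ContMDiff 𝓘(ℝ, ℍ[ℝ]) 𝓘(ℝ, ℍ[ℝ]) n fun p : U => ‖(p : ℍ[ℝ])‖⁻¹ • (p : ℍ[ℝ]) := by
    intro p
    have hp : (p : ℍ[ℝ]) ≠ 0 := p.2
    refine (contMDiffAt_subtype_iff (U := U) (f := fun p : ℍ[ℝ] => ‖p‖⁻¹ • p)).2 ?_
    exact (((contDiffAt_norm ℝ hp).inv (norm_ne_zero_iff.2 hp)).smul contDiffAt_id).contMDiffAt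
  have h2 := h.codRestrict_sphere (n := 3) fun p => by
    have hp : (p : ℍ[ℝ]) ≠ 0 := p.2
    simp [norm_smul, hp]
  refine (contMDiffAt_subtype_iff (U := U) (x := ⟨x, hx⟩) (f := radial)).1 ?_
  convert! h2 ⟨x, hx⟩ using 1
  funext p
  have hp : (p : ℍ[ℝ]) ≠ 0 := p.2
  simp [radial, hp]
  rfl

theorem contDiffAt_comp_radial {n : ℕ∞ω} {f : S3 → ℍ[ℝ]}
    (hf : ContMDiff (𝓡 3) 𝓘(ℝ, ℍ[ℝ]) n f) {x : ℍ[ℝ]} (hx : x ≠ 0) :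
    ContDiffAt ℝ n (f ∘ radial) x :=
  contMDiffAt_iff_contDiffAt.1 ((hf (radial x)).comp x (contMDiffAt_radial hx))

/-- Since `f ∘ radial` extends `f`, the chain rule turns derivatives along the frame into ordinary
derivatives in `ℍ` in the directions `eᵢ y`. -/
theorem mvfderiv_eq_fderiv_comp_radial {f : S3 → ℍ[ℝ]} (hf : SmoothMap f) (y : S3) :
    mvfderiv (𝓡 3) f y = (fderiv ℝ (f ∘ radial) y).comp (dincl y) := by
  have hd := (contDiffAt_comp_radial hf (ne_zero_of_mem_unit_sphere y)).differentiableAt (by simp)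
  have h := mfderiv_comp (I := 𝓡 3) (I' := 𝓘(ℝ, ℍ[ℝ])) (I'' := 𝓘(ℝ, ℍ[ℝ])) y
    (g := f ∘ radial) (f := incl) hd.mdifferentiableAt
    ((contMDiff_incl (n := 1)).mdifferentiableAt one_ne_zero)
  have h2 : (f ∘ radial) ∘ incl = f := by
    funext y
    exact congrArg f (radial_coe y)
  rw [h2, mfderiv_eq_fderiv] at h
  exact h

theorem dirDeriv_stdFrame {f : S3 → ℍ[ℝ]} (hf : SmoothMap f) (i : Fin 3) (y : S3) :
    dirDeriv (stdFrame i) f y = fderiv ℝ (f ∘ radial) y (imUnit i * (y : ℍ[ℝ])) := by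
  rw [dirDeriv, mvfderiv_eq_fderiv_comp_radial hf, ← dincl_stdFrame]
  rfl

/-! ### Invariance of the surface measure and integration by parts -/

instance isOpenPosMeasure_sphereMeasure : sphereMeasure.IsOpenPosMeasure :=
  inferInstanceAs (MeasureTheory.volume : MeasureTheory.Measure ℍ[ℝ]).toSphere.IsOpenPosMeasure

instance isFiniteMeasure_sphereMeasure : MeasureTheory.IsFiniteMeasure sphereMeasure :=
  inferInstanceAs (MeasureTheory.IsFiniteMeasure
    (MeasureTheory.volume : MeasureTheory.Measure ℍ[ℝ]).toSphere)

theorem continuous_rotate (i : Fin 3) (t : ℝ) : Continuous (rotate i t) :=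
  Continuous.subtype_mk (continuous_const.mul continuous_subtype_val) _

open Pointwise in
theorem measurePreserving_rotate (i : Fin 3) (t : ℝ) :
    MeasureTheory.MeasurePreserving (rotate i t) sphereMeasure sphereMeasure := by
  refine ⟨(continuous_rotate i t).measurable, ?_⟩
  ext s hs
  let L : ℍ[ℝ] →ₗᵢ[ℝ] ℍ[ℝ] :=
    { LinearMap.mulLeft ℝ (expUnit i t) with
      norm_map' := fun x => by
        change ‖expUnit i t * x‖ = ‖x‖
        rw [norm_mul, norm_expUnit, one_mul] }
  have hL : MeasureTheory.MeasurePreserving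
      (L.toLinearIsometryEquiv rfl).toHomeomorph.toMeasurableEquiv :=
    (L.toLinearIsometryEquiv rfl).measurePreserving
  have hm : MeasurableSet (rotate i t ⁻¹' s) := (continuous_rotate i t).measurable hs
  -- The surface measure of `s` is four times the volume of the cone `(0, 1) • s`, and the linear
  -- isometry `L` matches the cones over `s` and over its preimage.
  have hset : (L.toLinearIsometryEquiv rfl).toHomeomorph.toMeasurableEquiv ⁻¹' (Set.Ioo (0 : ℝ) 1 • ((↑) '' s : Set ℍ[ℝ])) =
      Set.Ioo (0 : ℝ) 1 • ((↑) '' (rotate i t ⁻¹' s) : Set ℍ[ℝ]) := by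
    ext x
    simp only [Set.mem_preimage, Set.mem_smul, Set.mem_image]
    constructor
    · rintro ⟨r, hr, _, ⟨y, hy, rfl⟩, h⟩
      have hu : star (expUnit i t) * expUnit i t = 1 := by
        rw [Quaternion.star_mul_self, Quaternion.normSq_eq_norm_mul_self, norm_expUnit]
        simp
      refine ⟨r, hr, _, ⟨⟨star (expUnit i t) * y, by simp [norm_expUnit]⟩, ?_, rfl⟩, ?_⟩
      · have hu' : expUnit i t * star (expUnit i t) = 1 := by
          rw [Quaternion.self_mul_star, Quaternion.normSq_eq_norm_mul_self, norm_expUnit]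
          simp
        convert! hy using 1
        exact Subtype.ext (by simp [rotate, ← mul_assoc, hu'])
      · have h' : r • (y : ℍ[ℝ]) = expUnit i t * x := h
        rw [← mul_smul_comm, h', ← mul_assoc, hu, one_mul]
    · rintro ⟨r, hr, _, ⟨y, hy, rfl⟩, rfl⟩
      exact ⟨r, hr, _, ⟨_, hy, rfl⟩, (map_smul L r (y : ℍ[ℝ])).symm⟩
  rw [MeasureTheory.Measure.map_apply (continuous_rotate i t).measurable hs, sphereMeasure,
    MeasureTheory.Measure.toSphere_apply' _ hm, MeasureTheory.Measure.toSphere_apply' _ hs,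
    ← hset, hL.measure_preimage_equiv]

theorem integrable_sphere {E : Type*} [NormedAddCommGroup E] {g : S3 → E} (hg : Continuous g) :
    MeasureTheory.Integrable g sphereMeasure :=
  hg.integrable_of_hasCompactSupport (HasCompactSupport.of_compactSpace g)

theorem continuous_sphere_of_contDiffAt {E : Type*} [NormedAddCommGroup E] [NormedSpace ℝ E]
    {n : ℕ∞ω} {h : ℍ[ℝ] → E} (hh : ∀ x ≠ 0, ContDiffAt ℝ n h x) :
    Continuous fun y : S3 => h y :=
  continuous_iff_continuousAt.2 fun y =>
    (hh y (ne_zero_of_mem_unit_sphere y)).continuousAt.comp continuous_subtype_val.continuousAt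

/-- The derivative of `h` along the field `eᵢ x` on `ℍ`. -/
noncomputable def unitDeriv {E : Type*} [NormedAddCommGroup E] [NormedSpace ℝ E] (i : Fin 3)
    (h : ℍ[ℝ] → E) (x : ℍ[ℝ]) : E := fderiv ℝ h x (imUnit i * x)

theorem contDiffAt_unitDeriv {E : Type*} [NormedAddCommGroup E] [NormedSpace ℝ E] (i : Fin 3)
    {m n : ℕ∞ω} {h : ℍ[ℝ] → E} {x : ℍ[ℝ]} (hh : ContDiffAt ℝ n h x) (hmn : m + 1 ≤ n) :
    ContDiffAt ℝ m (unitDeriv i h) x :=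
  (hh.fderiv_right hmn).clm_apply (contDiffAt_const.mul contDiffAt_id)

/-- The integral of `h (rotate i t y)` does not depend on `t`; differentiate it at `t = 0` under the
integral sign. Compactness supplies the dominating constant. -/
theorem integral_unitDeriv_eq_zero (i : Fin 3) {h : ℍ[ℝ] → ℝ}
    (hh : ∀ x ≠ 0, ContDiffAt ℝ 1 h x) : ∫ y : S3, unitDeriv i h y ∂sphereMeasure = 0 := by
  have hc : Continuous fun y : S3 => unitDeriv i h y :=
    continuous_sphere_of_contDiffAt fun x hx => contDiffAt_unitDeriv i (m := 0) (hh x hx) (by simp)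
  have hc0 : Continuous fun y : S3 => h y := continuous_sphere_of_contDiffAt hh
  obtain ⟨C, hC⟩ := (isCompact_range hc).isBounded.exists_norm_le
  have key := (hasDerivAt_integral_of_dominated_loc_of_deriv_le (μ := sphereMeasure)
    (F := fun t (y : S3) => h (rotate i t y)) (F' := fun t (y : S3) => unitDeriv i h (rotate i t y))
    (x₀ := 0) (s := Set.univ) (bound := fun _ => C) Filter.univ_mem
    (Filter.Eventually.of_forall fun t =>
      (hc0.comp (continuous_rotate i t)).aestronglyMeasurable)
    (integrable_sphere (hc0.comp (continuous_rotate i 0)))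
    (hc.comp (continuous_rotate i 0)).aestronglyMeasurable
    (Filter.Eventually.of_forall fun y t _ => hC _ ⟨_, rfl⟩)
    (MeasureTheory.integrable_const C)
    (Filter.Eventually.of_forall fun y t _ => ?_)).2
  · have h1 (t : ℝ) : ∫ y : S3, h (rotate i t y) ∂sphereMeasure = ∫ y : S3, h y ∂sphereMeasure :=
      (MeasureTheory.integral_map (continuous_rotate i t).aemeasurable
        hc0.aestronglyMeasurable).symm.trans (by rw [(measurePreserving_rotate i t).map_eq])
    simp only [h1, rotate_zero] at key
    exact key.unique (hasDerivAt_const _ _)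
  · have h1 : HasDerivAt (fun t => expUnit i t * (y : ℍ[ℝ]))
        (imUnit i * (rotate i t y : ℍ[ℝ])) t := by
      have := (hasDerivAt_expUnit i t).mul_const (y : ℍ[ℝ])
      rwa [mul_assoc] at this
    exact (((hh _ (ne_zero_of_mem_unit_sphere (rotate i t y))).differentiableAt
      one_ne_zero).hasFDerivAt.comp_hasDerivAt t h1)

/-- The bracket relation as an identity of operators: the minus sign reflects the convention
`L_{[u,w]} = -[L_u, L_w]`. -/
theorem unitDeriv_unitDeriv_sub {E : Type*} [NormedAddCommGroup E] [NormedSpace ℝ E] (i : Fin 3)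
    {h : ℍ[ℝ] → E} {x : ℍ[ℝ]} (hh : ContDiffAt ℝ 2 h x) :
    unitDeriv (i + 1) (unitDeriv (i + 2) h) x - unitDeriv (i + 2) (unitDeriv (i + 1) h) x =
      -(2 : ℝ) • unitDeriv i h x := by
  have hs : IsSymmSndFDerivAt ℝ h x := hh.isSymmSndFDerivAt (by simp)
  have h2 : HasFDerivAt (fderiv ℝ h) (fderiv ℝ (fderiv ℝ h) x) x :=
    ((hh.fderiv_right (m := 1) le_rfl).differentiableAt one_ne_zero).hasFDerivAt
  have h3 (j k : Fin 3) : unitDeriv j (unitDeriv k h) x =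
      fderiv ℝ (fderiv ℝ h) x (imUnit j * x) (imUnit k * x) +
        fderiv ℝ h x (imUnit k * (imUnit j * x)) := by
    have := h2.clm_apply ((hasFDerivAt_id x).const_mul (imUnit k))
    refine (congrArg (fun L => L (imUnit j * x)) this.fderiv).trans ?_
    simp [add_comm]
  rw [h3, h3, hs.eq, add_sub_add_left_eq_sub, ← map_sub, unitDeriv, ← map_smul,
    ← smul_mul_assoc, neg_smul, ← imUnit_commutator]
  congr 1
  noncomm_ring

theorem inner_imUnit_mul (i : Fin 3) (a b : ℍ[ℝ]) :
    inner ℝ a (imUnit i * b) = -inner ℝ (imUnit i * a) b := by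
  rw [Quaternion.inner_def, Quaternion.inner_def]
  fin_cases i <;> simp [coords_imUnit] <;> ring

theorem unitDeriv_inner (i j : Fin 3) {g k : ℍ[ℝ] → ℍ[ℝ]} {x : ℍ[ℝ]}
    (hg : DifferentiableAt ℝ g x) (hk : DifferentiableAt ℝ k x) :
    unitDeriv i (fun x => inner ℝ (g x) (imUnit j * k x)) x =
      inner ℝ (unitDeriv i g x) (imUnit j * k x) + inner ℝ (g x) (imUnit j * unitDeriv i k x) := by
  rw [unitDeriv, (hg.hasFDerivAt.inner ℝ (hk.hasFDerivAt.const_mul (imUnit j))).fderiv]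
  simp [unitDeriv, add_comm]

/-- Write `Dⱼ` for `unitDeriv j`. The combination `Dᵢ₊₁⟨F, eᵢ Dᵢ₊₂ F⟩ - Dᵢ₊₂⟨F, eᵢ Dᵢ₊₁ F⟩` has
integral zero. Skewness of `eᵢ` doubles the first order products, and the commutator of the
derivatives contributes `-2⟨F, eᵢ Dᵢ F⟩`. -/
theorem integral_inner_unitDeriv (i : Fin 3) {F : ℍ[ℝ] → ℍ[ℝ]}
    (hF : ∀ x ≠ 0, ContDiffAt ℝ ∞ F x) :
    ∫ y : S3, inner ℝ (unitDeriv (i + 1) F y) (imUnit i * unitDeriv (i + 2) F y) ∂sphereMeasure =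
      ∫ y : S3, inner ℝ (F y) (imUnit i * unitDeriv i F y) ∂sphereMeasure := by
  have hD (j : Fin 3) : ∀ x ≠ 0, ContDiffAt ℝ ∞ (unitDeriv j F) x := fun x hx =>
    contDiffAt_unitDeriv j (hF x hx) le_rfl
  have hI (j : Fin 3) : ∀ x ≠ 0,
      ContDiffAt ℝ ∞ (fun x => inner ℝ (F x) (imUnit i * unitDeriv j F x)) x :=
    fun x hx => (hF x hx).inner ℝ (contDiffAt_const.mul (hD j x hx))
  have h0 (j k : Fin 3) : MeasureTheory.Integrable (fun y : S3 => unitDeriv j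
      (fun x => inner ℝ (F x) (imUnit i * unitDeriv k F x)) y) sphereMeasure :=
    integrable_sphere (continuous_sphere_of_contDiffAt (n := ∞) fun x hx =>
      contDiffAt_unitDeriv j (hI k x hx) le_rfl)
  have h1 (j k : Fin 3) : ∫ y : S3, unitDeriv j
      (fun x => inner ℝ (F x) (imUnit i * unitDeriv k F x)) y ∂sphereMeasure = 0 :=
    integral_unitDeriv_eq_zero j fun x hx => (hI k x hx).of_le (by simp)
  have h2 : ∫ y : S3, (unitDeriv (i + 1)
      (fun x => inner ℝ (F x) (imUnit i * unitDeriv (i + 2) F x)) y - unitDeriv (i + 2)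
      (fun x => inner ℝ (F x) (imUnit i * unitDeriv (i + 1) F x)) y) ∂sphereMeasure = 0 := by
    rw [MeasureTheory.integral_sub (h0 _ _) (h0 _ _), h1, h1, sub_zero]
  have h3 (y : S3) : unitDeriv (i + 1)
      (fun x => inner ℝ (F x) (imUnit i * unitDeriv (i + 2) F x)) y - unitDeriv (i + 2)
      (fun x => inner ℝ (F x) (imUnit i * unitDeriv (i + 1) F x)) y =
      2 * (inner ℝ (unitDeriv (i + 1) F y) (imUnit i * unitDeriv (i + 2) F y) -
        inner ℝ (F y) (imUnit i * unitDeriv i F y)) := by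
    have hy := ne_zero_of_mem_unit_sphere y
    have hd (j : Fin 3) := (hD j y hy).differentiableAt (by simp)
    have hd0 := (hF y hy).differentiableAt (by simp)
    have hc := unitDeriv_unitDeriv_sub i ((hF y hy).of_le ENat.LEInfty.out)
    rw [sub_eq_iff_eq_add] at hc
    rw [unitDeriv_inner _ _ hd0 (hd _), unitDeriv_inner _ _ hd0 (hd _), hc,
      inner_imUnit_mul i (unitDeriv (i + 2) F y), real_inner_comm _ (imUnit i * _)]
    simp only [mul_add, inner_add_right, mul_smul_comm, inner_smul_right]
    ring
  have hi : MeasureTheory.Integrable (fun y : S3 => inner ℝ (unitDeriv (i + 1) F y)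
      (imUnit i * unitDeriv (i + 2) F y)) sphereMeasure :=
    integrable_sphere (continuous_sphere_of_contDiffAt (n := ∞) fun x hx =>
      (hD _ x hx).inner ℝ (contDiffAt_const.mul (hD _ x hx)))
  have hi' : MeasureTheory.Integrable (fun y : S3 => inner ℝ (F y)
      (imUnit i * unitDeriv i F y)) sphereMeasure :=
    integrable_sphere (continuous_sphere_of_contDiffAt (hI i))
  simp only [h3] at h2
  rw [MeasureTheory.integral_const_mul, MeasureTheory.integral_sub hi hi'] at h2
  linarith

/-- The cross terms are `⟨eⱼ aⱼ, eₖ aₖ⟩ = -⟨aⱼ, eⱼ eₖ aₖ⟩`, and `eⱼ eₖ = eᵢ` for cyclic indices. -/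
theorem norm_sum_imUnit_mul_sq (a : Fin 3 → ℍ[ℝ]) :
    ‖∑ i, imUnit i * a i‖ ^ 2 =
      ∑ i, ‖a i‖ ^ 2 - 2 * ∑ i : Fin 3, inner ℝ (a (i + 1)) (imUnit i * a (i + 2)) := by
  simp only [pow_two, ← Quaternion.normSq_eq_norm_mul_self, Quaternion.normSq_def',
    Quaternion.inner_def, Fin.sum_univ_three]
  simp [coords_imUnit]
  ring

theorem energy_identity {f : S3 → ℍ[ℝ]} (hf : SmoothMap f) :
    (1 / 2 : ℝ) * ∫ y, ∑ i, ‖dirDeriv (stdFrame i) f y‖ ^ 2 ∂sphereMeasure =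
      (1 / 2 : ℝ) * ∫ y, ‖fueter stdFrame f y‖ ^ 2 ∂sphereMeasure
        + ∫ y, inner ℝ (f y) (fueter stdFrame f y) ∂sphereMeasure := by
  set F := f ∘ radial with hFdef
  have hF : ∀ x ≠ 0, ContDiffAt ℝ ∞ F x := fun x hx => contDiffAt_comp_radial hf hx
  have hD (j : Fin 3) : ∀ x ≠ 0, ContDiffAt ℝ ∞ (unitDeriv j F) x := fun x hx =>
    contDiffAt_unitDeriv j (hF x hx) le_rfl
  have hc (j : Fin 3) : Continuous fun y : S3 => unitDeriv j F y :=
    continuous_sphere_of_contDiffAt (hD j)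
  have hc0 : Continuous fun y : S3 => F y := continuous_sphere_of_contDiffAt hF
  have hfF (y : S3) : f y = F y := (congrArg f (radial_coe y)).symm
  have hdir (j : Fin 3) (y : S3) : dirDeriv (stdFrame j) f y = unitDeriv j F y :=
    dirDeriv_stdFrame hf j y
  have h1 : ∫ y, inner ℝ (f y) (fueter stdFrame f y) ∂sphereMeasure =
      ∑ i : Fin 3, ∫ y : S3, inner ℝ (unitDeriv (i + 1) F y) (imUnit i * unitDeriv (i + 2) F y)
        ∂sphereMeasure := by
    simp only [fueter, hdir, hfF, inner_sum]
    rw [MeasureTheory.integral_finsetSum _ fun i _ =>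
      integrable_sphere (hc0.inner (continuous_const.mul (hc i)))]
    exact Finset.sum_congr rfl fun i _ => (integral_inner_unitDeriv i hF).symm
  have hi (i : Fin 3) : MeasureTheory.Integrable (fun y : S3 =>
      inner ℝ (unitDeriv (i + 1) F y) (imUnit i * unitDeriv (i + 2) F y)) sphereMeasure :=
    integrable_sphere ((hc _).inner (continuous_const.mul (hc _)))
  rw [h1]
  simp only [fueter, hdir, norm_sum_imUnit_mul_sq]
  rw [MeasureTheory.integral_sub (integrable_sphere (by fun_prop))
    ((MeasureTheory.integrable_finsetSum _ fun i _ => hi i).const_mul 2),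
    MeasureTheory.integral_const_mul, MeasureTheory.integral_finsetSum _ fun i _ => hi i]
  ring

/-! ### Regularity of the standard frame -/

theorem constant_of_dirDeriv_eq_zero {f : S3 → ℍ[ℝ]} (hf : SmoothMap f)
    (h : ∀ i y, dirDeriv (stdFrame i) f y = 0) : ∃ c, ∀ y, f y = c := by
  have hzero (y : S3) (u : TangentSpace (𝓡 3) y) : mvfderiv (𝓡 3) f y u = 0 := by
    rw [← sum_coframe_smul_stdFrame y u, map_sum]
    refine Finset.sum_eq_zero fun i _ => ?_
    rw [map_smul]
    exact (congrArg _ (h i y)).trans (smul_zero _)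
  have hloc : IsLocallyConstant f := by
    refine (IsLocallyConstant.iff_eventually_eq f).2 fun x => ?_
    have hd : Differentiable ℝ (f ∘ (extChartAt (𝓡 3) x).symm) :=
      (contMDiff_iff_contDiff.1
        (hf.comp (contMDiff_extChartAt_symm_sphere x))).differentiable (by simp)
    have h0 (z : E3) : fderiv ℝ (f ∘ (extChartAt (𝓡 3) x).symm) z = 0 := by
      ext1 v
      have hcomp := mfderiv_comp_apply (I := 𝓘(ℝ, E3)) (I' := 𝓡 3) (I'' := 𝓘(ℝ, ℍ[ℝ])) z
        (g := f) (f := (extChartAt (𝓡 3) x).symm) (hf.mdifferentiableAt (by simp))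
        ((contMDiff_extChartAt_symm_sphere (n := 1) x).mdifferentiableAt one_ne_zero) v
      rw [mfderiv_eq_fderiv] at hcomp
      exact hcomp.trans (hzero _ _)
    filter_upwards [extChartAt_source_mem_nhds (I := 𝓡 3) x] with y hy
    have := is_const_of_fderiv_eq_zero hd h0 (extChartAt (𝓡 3) x y) (extChartAt (𝓡 3) x x)
    rwa [Function.comp_apply, Function.comp_apply, (extChartAt (𝓡 3) x).left_inv hy,
      extChartAt_to_inv] at this
  have hpre : PreconnectedSpace S3 := by
    refine Subtype.preconnectedSpace (isPreconnected_sphere ?_ 0 1)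
    rw [← Module.finrank_eq_rank, Quaternion.finrank_eq_four]
    norm_num
  exact ⟨f ⟨1, by simp⟩, fun y => hloc.apply_eq_of_preconnectedSpace _ _⟩

theorem onlyConstantSolutions_stdFrame : OnlyConstantSolutions stdFrame := by
  intro f hf h0
  have he := energy_identity hf
  have hc : Continuous fun y => ∑ i, ‖dirDeriv (stdFrame i) f y‖ ^ 2 := by
    have hd (j : Fin 3) : Continuous fun y : S3 => dirDeriv (stdFrame j) f y := by
      rw [show (fun y : S3 => dirDeriv (stdFrame j) f y) = _ from
        funext (dirDeriv_stdFrame hf j)]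
      exact continuous_sphere_of_contDiffAt (n := ∞) fun x hx =>
        contDiffAt_unitDeriv j (contDiffAt_comp_radial hf hx) le_rfl
    fun_prop
  simp only [h0, inner_zero_right, norm_zero] at he
  have h1 : ∫ y, ∑ i, ‖dirDeriv (stdFrame i) f y‖ ^ 2 ∂sphereMeasure = 0 := by
    simpa using he
  rw [MeasureTheory.integral_eq_zero_iff_of_nonneg (fun y => by positivity)
    (integrable_sphere hc)] at h1
  -- The measure is positive on nonempty open sets, so a continuous function vanishing almost
  -- everywhere vanishes identically.
  have h2 := hc.ae_eq_iff_eq sphereMeasure continuous_zero |>.1 h1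
  refine constant_of_dirDeriv_eq_zero hf fun i y => ?_
  have h3 := (Finset.sum_eq_zero_iff_of_nonneg fun i _ => by positivity).1 (congrFun h2 y) i
    (Finset.mem_univ i)
  simpa using h3

/-! ### The measure of the volume form, by polar coordinates -/

open MeasureTheory
open scoped Pointwise

/-- The coordinates of a quaternion. -/
noncomputable def quatCoords : ℍ[ℝ] →L[ℝ] Fin 4 → ℝ :=
  (EuclideanSpace.equiv (Fin 4) ℝ : EuclideanSpace ℝ (Fin 4) →L[ℝ] Fin 4 → ℝ).comp
    (Quaternion.linearIsometryEquivTuple.toContinuousLinearEquiv :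
      ℍ[ℝ] →L[ℝ] EuclideanSpace ℝ (Fin 4))

theorem quatCoords_apply (q : ℍ[ℝ]) : quatCoords q = ![q.re, q.imI, q.imJ, q.imK] := rfl

theorem volume_image_quatCoords (K : Set ℍ[ℝ]) : volume (quatCoords '' K) = volume K := by
  let e : ℍ[ℝ] ≃ᵐ (Fin 4 → ℝ) :=
    Quaternion.linearIsometryEquivTuple.toHomeomorph.toMeasurableEquiv.trans
      (MeasurableEquiv.toLp 2 (Fin 4 → ℝ)).symm
  have he : MeasurePreserving e :=
    Quaternion.linearIsometryEquivTuple.measurePreserving.trans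
      (EuclideanSpace.volume_preserving_symm_measurableEquiv_toLp (Fin 4))
  have h : e ⁻¹' (quatCoords '' K) = K := Set.preimage_image_eq K e.injective
  rw [← he.measure_preimage_equiv, h]

/-- Split off the first coordinate of a point of `ℝ⁴`. -/
noncomputable def tailCLM : (Fin 4 → ℝ) →L[ℝ] E3 :=
  ((EuclideanSpace.equiv (Fin 3) ℝ).symm : (Fin 3 → ℝ) →L[ℝ] E3).comp
    (ContinuousLinearMap.pi fun i => ContinuousLinearMap.proj i.succ)

theorem measurePreserving_head_tail :
    MeasurePreserving (fun w : Fin 4 → ℝ => (w 0, tailCLM w)) := by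
  have h1 := volume_preserving_piFinSuccAbove (fun _ : Fin 4 => ℝ) 0
  have h2 : MeasurePreserving (Prod.map id (@WithLp.toLp 2 (Fin 3 → ℝ)) : ℝ × (Fin 3 → ℝ) → _) :=
    (MeasurePreserving.id volume).prod (PiLp.volume_preserving_toLp (Fin 3))
  exact h2.comp h1

theorem lintegral_cube : ∫⁻ r in Set.Ioo (0 : ℝ) 1, ENNReal.ofReal (r ^ 3) = 4⁻¹ := by
  rw [← ofReal_integral_eq_lintegral_ofReal]
  · rw [← integral_Ioc_eq_integral_Ioo, ← intervalIntegral.integral_of_le zero_le_one,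
      integral_pow]
    norm_num
    rw [one_div, ENNReal.ofReal_inv_of_pos (by norm_num)]
    norm_num
  · exact ((continuous_pow 3).integrableOn_Icc (a := (0 : ℝ)) (b := 1)).mono_set
      Set.Ioo_subset_Icc_self
  · filter_upwards [ae_restrict_mem measurableSet_Ioo] with r hr
    exact pow_nonneg hr.1.le 3

/-- Polar coordinates based on the chart centred at `x`. -/
noncomputable def polarMap (x : S3) (w : Fin 4 → ℝ) : ℍ[ℝ] := w 0 • param x (tailCLM w)

/-- The differential of `polarMap`, in coordinates. -/
noncomputable def polarDeriv (x : S3) (w : Fin 4 → ℝ) : (Fin 4 → ℝ) →L[ℝ] Fin 4 → ℝ :=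
  quatCoords.comp (w 0 • (fderiv ℝ (param x) (tailCLM w)).comp tailCLM +
    (ContinuousLinearMap.proj 0).smulRight (param x (tailCLM w)))

theorem hasFDerivAt_polarMap (x : S3) (w : Fin 4 → ℝ) :
    HasFDerivAt (fun w => quatCoords (polarMap x w)) (polarDeriv x w) w := by
  have h1 : HasFDerivAt (param x) (fderiv ℝ (param x) (tailCLM w)) (tailCLM w) :=
    ((contDiff_param (n := 1) x).differentiable one_ne_zero _).hasFDerivAt
  have h2 := h1.comp w tailCLM.hasFDerivAt
  exact quatCoords.hasFDerivAt.comp w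
    ((ContinuousLinearMap.proj (R := ℝ) (φ := fun _ : Fin 4 => ℝ) 0).hasFDerivAt.smul h2)

theorem dvol_inChart_eq (x : S3) (z : E3) : dvol.inChart x z =
    ((param x z).re • wedge ![dy 1, dy 2, dy 3] - (param x z).imI • wedge ![dy 0, dy 2, dy 3]
    - (param x z).imJ • wedge ![dy 0, dy 3, dy 1]
    - (param x z).imK • wedge ![dy 0, dy 1, dy 2]).compContinuousLinearMap
      (fderiv ℝ (param x) z) :=
  inChart_pullback (fun p => p.re • wedge ![dy 1, dy 2, dy 3] - p.imI • wedge ![dy 0, dy 2, dy 3]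
    - p.imJ • wedge ![dy 0, dy 3, dy 1] - p.imK • wedge ![dy 0, dy 1, dy 2]) x z

theorem tailCLM_single_zero : tailCLM (Pi.single 0 1) = 0 := by
  ext i
  change (Pi.single 0 1 : Fin 4 → ℝ) i.succ = 0
  simp

theorem tailCLM_single_succ (j : Fin 3) :
    tailCLM (Pi.single j.succ 1) = EuclideanSpace.single j 1 := by
  ext i
  change (Pi.single j.succ 1 : Fin 4 → ℝ) i.succ = _
  simp [Pi.single_apply]

/-- The columns are `p` and `r ∂ⱼ p`. The three factors `r` come out, and expanding `det (p, ∂₁p,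
∂₂p, ∂₃p)` along its first column is exactly the formula defining `dvol`. -/
theorem det_polarDeriv (x : S3) (w : Fin 4 → ℝ) : (polarDeriv x w).det =
    w 0 ^ 3 * dvol.inChart x (tailCLM w) fun i => EuclideanSpace.single i 1 := by
  rw [dvol_inChart_eq, ContinuousLinearMap.det, ← LinearMap.det_toMatrix']
  set p := param x (tailCLM w)
  have h0 : polarDeriv x w (Pi.single 0 1) = quatCoords p := by
    simp [polarDeriv, tailCLM_single_zero, p]
  have h1 (j : Fin 3) : polarDeriv x w (Pi.single j.succ 1) =
      w 0 • quatCoords (fderiv ℝ (param x) (tailCLM w) (EuclideanSpace.single j 1)) := by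
    simp [polarDeriv, tailCLM_single_succ]
  simp only [ContinuousAlternatingMap.compContinuousLinearMap_apply,
    ContinuousAlternatingMap.sub_apply, ContinuousAlternatingMap.smul_apply, wedge_apply,
    Function.comp_def]
  generalize ha : (fun j => fderiv ℝ (param x) (tailCLM w) (EuclideanSpace.single j 1)) = a
  have ha' (j : Fin 3) : fderiv ℝ (param x) (tailCLM w) (EuclideanSpace.single j 1) = a j :=
    congrFun ha j
  have hM : LinearMap.toMatrix' (polarDeriv x w : (Fin 4 → ℝ) →ₗ[ℝ] Fin 4 → ℝ) =
      Matrix.of fun i j => (![quatCoords p, w 0 • quatCoords (a 0), w 0 • quatCoords (a 1),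
        w 0 • quatCoords (a 2)] : Fin 4 → Fin 4 → ℝ) j i := by
    ext i j
    rw [LinearMap.toMatrix'_apply]
    refine congrFun (?_ : polarDeriv x w (Pi.single j 1) = _) i
    simp only [ha'] at h1
    fin_cases j
    exacts [h0, h1 0, h1 1, h1 2]
  rw [hM, Matrix.det_succ_column_zero]
  simp only [ha', Matrix.det_fin_three, Fin.sum_univ_four]
  simp [Fin.succAbove, quatCoords_apply, dy_zero, dy_one, dy_two, dy_three]
  ring

theorem isMeasureOf_sphereMeasure : IsMeasureOf sphereMeasure dvol := by
  intro x A hA hAx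
  set B := extChartAt (𝓡 3) x '' A with hB
  set J : E3 → ENNReal := fun z =>
    ENNReal.ofReal |dvol.inChart x z fun i => EuclideanSpace.single i 1| with hJ
  have hsymm : Continuous (extChartAt (𝓡 3) x).symm :=
    (contMDiff_extChartAt_symm_sphere (n := 0) x).continuous
  have hright (z : E3) : extChartAt (𝓡 3) x ((extChartAt (𝓡 3) x).symm z) = z :=
    (extChartAt (𝓡 3) x).right_inv (by rw [extChartAt_sphere_target]; trivial)
  have hBeq : B = (extChartAt (𝓡 3) x).symm ⁻¹' A := by
    ext z
    constructor
    · rintro ⟨y, hy, rfl⟩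
      rwa [Set.mem_preimage, (extChartAt (𝓡 3) x).left_inv (hAx hy)]
    · exact fun hz => ⟨_, hz, hright z⟩
  have hBm : MeasurableSet B := hBeq ▸ hsymm.measurable hA
  have hJm : Measurable J := by
    have hd : Continuous (dvol.inChart x) := by
      rw [← continuousOn_univ, ← extChartAt_sphere_target x]
      exact (isVolumeForm_dvol.1 x).continuousOn
    have : Continuous fun z => dvol.inChart x z fun i => EuclideanSpace.single i (1 : ℝ) := by
      fun_prop
    exact (ENNReal.continuous_ofReal.comp this.abs).measurable
  set S : Set (Fin 4 → ℝ) := (fun w => (w 0, tailCLM w)) ⁻¹' (Set.Ioo (0 : ℝ) 1 ×ˢ B) with hS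
  have hSm : MeasurableSet S :=
    measurePreserving_head_tail.measurable (measurableSet_Ioo.prod hBm)
  -- The cone over `A` is the polar image of the product `(0, 1) × B`, so the change of variables
  -- formula computes its volume.
  have himage : Set.Ioo (0 : ℝ) 1 • ((↑) '' A : Set ℍ[ℝ]) = polarMap x '' S := by
    ext q
    constructor
    · rintro ⟨r, hr, _, ⟨y, hy, rfl⟩, rfl⟩
      refine ⟨Fin.cons r (extChartAt (𝓡 3) x y).ofLp, ⟨hr, y, hy, rfl⟩, ?_⟩
      change r • param x (extChartAt (𝓡 3) x y) = r • (y : ℍ[ℝ])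
      rw [param, (extChartAt (𝓡 3) x).left_inv (hAx hy)]
    · rintro ⟨w, ⟨hr, hz⟩, rfl⟩
      exact ⟨w 0, hr, _, ⟨(extChartAt (𝓡 3) x).symm (tailCLM w), hBeq.subset hz, rfl⟩, rfl⟩
  have hinj : Set.InjOn (fun w => quatCoords (polarMap x w)) S := by
    rintro w ⟨⟨hw, -⟩, -⟩ w' ⟨⟨hw', -⟩, -⟩ h
    have hq : polarMap x w = polarMap x w' := by
      have hinjT : Function.Injective quatCoords :=
        (EuclideanSpace.equiv (Fin 4) ℝ).injective.comp
          Quaternion.linearIsometryEquivTuple.injective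
      exact hinjT h
    have hr : w 0 = w' 0 := by
      have := congrArg norm hq
      rwa [polarMap, polarMap, norm_smul, norm_smul, norm_param, norm_param, mul_one, mul_one,
        Real.norm_of_nonneg hw.le, Real.norm_of_nonneg hw'.le] at this
    have hp : param x (tailCLM w) = param x (tailCLM w') := by
      rw [polarMap, polarMap, hr] at hq
      exact smul_right_injective _ hw'.ne' hq
    have ht : tailCLM w = tailCLM w' := by
      rw [← hright (tailCLM w), ← hright (tailCLM w'), Subtype.ext hp]
    funext i
    refine Fin.cases hr (fun j => ?_) i
    exact congrArg (fun z : E3 => z j) ht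
  have hvol : volume (polarMap x '' S) = 4⁻¹ * ∫⁻ z in B, J z := by
    rw [← volume_image_quatCoords, Set.image_image,
      ← lintegral_abs_det_fderiv_eq_addHaar_image volume hSm
        (fun w _ => (hasFDerivAt_polarMap x w).hasFDerivWithinAt) hinj]
    have h1 : ∫⁻ w in S, ENNReal.ofReal |(polarDeriv x w).det| =
        ∫⁻ w in S, (fun q : ℝ × E3 => ENNReal.ofReal (q.1 ^ 3) * J q.2) (w 0, tailCLM w) := by
      refine setLIntegral_congr_fun hSm fun w hw => ?_
      have hw0 : 0 ≤ w 0 := hw.1.1.le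
      simp only [det_polarDeriv, abs_mul, abs_of_nonneg (pow_nonneg hw0 3)]
      exact ENNReal.ofReal_mul (pow_nonneg hw0 3)
    have hm3 : Measurable fun r : ℝ => ENNReal.ofReal (r ^ 3) := by fun_prop
    have h2 := measurePreserving_head_tail.setLIntegral_comp_preimage
      ((measurableSet_Ioo (a := (0 : ℝ)) (b := 1)).prod hBm) (f := fun q : ℝ × E3 => ENNReal.ofReal (q.1 ^ 3) * J q.2)
      ((hm3.comp measurable_fst).mul (hJm.comp measurable_snd))
    rw [h1, h2, Measure.volume_eq_prod, ← Measure.prod_restrict,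
      lintegral_prod_mul hm3.aemeasurable hJm.aemeasurable, lintegral_cube]
  -- The factor `dim ℍ = 4` in the definition of the surface measure cancels the radial integral
  -- `1/4`.
  rw [sphereMeasure, Measure.toSphere_apply' _ hA, himage, hvol, Quaternion.finrank_eq_four,
    ← mul_assoc]
  norm_num
  rw [ENNReal.mul_inv_cancel (by norm_num) (by norm_num), one_mul]

end Fueter

theorem mainTheorem10 :
    -- the volume form and its measure
    IsVolumeForm dvol ∧ IsMeasureOf sphereMeasure dvol ∧
    -- the standard frame is a normal regular divergence free frame
    IsRegularFrame dvol stdFrame ∧ IsNormal dvol stdFrame ∧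
    -- its dual frame, brackets and structure equations
    (∀ i j y, coframe i y (stdFrame j y) = if i = j then 1 else 0) ∧
    (∀ i : Fin 3, bracket (stdFrame (i + 1)) (stdFrame (i + 2)) = (2 : ℝ) • stdFrame i) ∧
    (∀ i : Fin 3, (coframeForm i).d = (2 : ℝ) • coframeWedge (i + 1) (i + 2) ∧
      (2 : ℝ) • coframeWedge (i + 1) (i + 2) = (2 : ℝ) • DForm.interior (stdFrame i) dvol) ∧
    -- the energy identity
    (∀ f : S3 → ℍ[ℝ], SmoothMap f →
      (1 / 2 : ℝ) * ∫ y, ∑ i, ‖dirDeriv (stdFrame i) f y‖ ^ 2 ∂sphereMeasure =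
        (1 / 2 : ℝ) * ∫ y, ‖fueter stdFrame f y‖ ^ 2 ∂sphereMeasure
          + ∫ y, inner ℝ (f y) (fueter stdFrame f y) ∂sphereMeasure) ∧
    -- the rescaled frame is a normal singular divergence free frame
    IsSingularFrame dvol scaledFrame ∧ IsNormal dvol scaledFrame ∧
    -- the inclusion is a nonconstant solution of its Fueter equation
    SmoothMap incl ∧ (∀ y, fueter scaledFrame incl y = 0) ∧ ¬ ∃ c, ∀ y, incl y = c := by
  exact ⟨isVolumeForm_dvol, isMeasureOf_sphereMeasure,
    ⟨isDivFreeFrame_stdFrame, onlyConstantSolutions_stdFrame⟩, isNormal_stdFrame,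
    coframe_stdFrame, bracket_stdFrame,
    fun i => ⟨d_coframeForm i, by rw [interior_stdFrame_dvol]⟩,
    fun f hf => energy_identity hf, isSingularFrame_scaledFrame, isNormal_scaledFrame,
    contMDiff_incl, fueter_scaledFrame_incl, not_constant_incl⟩
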